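/- Let $G$ be a discrete group and $c \subset G$ a conjugation-invariant subset; let $BG = G\backslash EG$ be the (Milnor) classifying space of $G$, with basepoint $\mathrm{pt}$ and $\pi_1(BG,\mathrm{pt})\cong G$; conjugation in $G$ makes $G$ act on $BG$ by pointed maps. For $n>0$ let $\mathrm{Hur}^c_{G,n}$ be the space of tuples $(t,\xi,f)$ where $t\in(0,\infty)$, $\xi$ is a configuration of $n$ distinct unordered points in $(0,t)\times(0,1)$, and $f:[0,t]\times[0,1]\setminus\xi\to BG$ is a continuous map that sends $(\{0,t\}\times[0,1])\cup([0,t]\times\{0\})$ to $\mathrm{pt}$ and sends a small (clockwise) loop around each point of $\xi$ to a loop representing an element of $c$. It carries the fibrewise compact-open topology over the space of pairs $(t,\xi)$. Let $\mathrm{Hur}=\coprod_{n\ge 0}\mathrm{Hur}^c_{G,n}$, where $\mathrm{Hur}^c_{G,0}=\{1\}$ is the unit of the multiplication $$(t,\xi,f)\cdot(t',\xi',f')=(t+t',\ \xi\amalg(\xi'+(t,0)),\ f''),\qquad f''(x,y)=\begin{cases} f(x,y) & 0\le x\le t,\\ f'(x-t,y) & t\le x\le t+t'.\end{cases}$$ Let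 $\mu:\mathrm{Hur}\to G$ be the global monodromy, which sends $(t,\xi,f)$ to the class in $\pi_1(BG,\mathrm{pt})\cong G$ of the restriction of $f$ to $[0,t]\times\{1\}$ and $1$ to $1$, and let $*$ be the left action of $G$ on $\mathrm{Hur}$ by postcomposition of $f$ with the action of $G$ on $BG$ induced by conjugation. Then the maps $\mathrm{Hur}\times\mathrm{Hur}\to\mathrm{Hur}$ given by $$(a,b)\longmapsto a\cdot b,\qquad (a,b)\longmapsto(\mu(a)*b)\cdot a$$ are continuous and homotopic. Moreover, for every field $k$, the localisation of $H_*(\mathrm{Hur};k)$ at $\pi_0(\mathrm{Hur})$ may be constructed by right fractions, that is, for every $r\in H_*(\mathrm{Hur};k)$ and every $s\in\pi_0(\mathrm{Hur})$: (i) there are $r'\in H_*(\mathrm{Hur};k)$ and $s'\in\pi_0(\mathrm{Hur})$ with $r\cdot s'=s\cdot r'$; (ii) if $s\cdot r=0$, then $r\cdot s'=0$ for some $s'\in\pi_0(\mathrm{Hur})$. Here $H_*$ is singular homology, and the product with the class of a point $a$ is induced by left, respectively right, multiplication by $a$. -/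

import Mathlib

open Set Filter Topology
open scoped unitInterval DirectSum

universe u

noncomputable section

/-! ### Milnor's model of the classifying space of a discrete group -/

/-- The total space `EG = G * G * G * ⋯` of Milnor's infinite join, for a discrete group `G`.
A point `∑ᵢ tᵢ gᵢ` (finitely many `tᵢ ≥ 0` are nonzero, `∑ᵢ tᵢ = 1`, and `gᵢ` only matters if
`tᵢ ≠ 0`) is recorded by its weights: `x i g = tᵢ` if `g = gᵢ`, and `x i g = 0` otherwise. -/
def EG (G : Type u) [Group G] : Type u :=
  {x : ℕ → G → ℝ // {p : ℕ × G | x p.1 p.2 ≠ 0}.Finite ∧ (∀ i g, 0 ≤ x i g) ∧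
    (∑ᶠ p : ℕ × G, x p.1 p.2) = 1 ∧ ∀ i g h, x i g ≠ 0 → x i h ≠ 0 → g = h}

namespace EG

variable {G : Type u} [Group G]

/-- The topology of pointwise convergence of the weights. As the weights are nonnegative and sum
to `1`, it is Milnor's topology, the coarsest one for which the `tᵢ` and the
`gᵢ : {tᵢ ≠ 0} → G` are continuous. -/
instance : TopologicalSpace (EG G) := instTopologicalSpaceSubtype

theorem finsum_relabel {H : Type u} (e : H ≃ H) (x : ℕ → H → ℝ) :
    (∑ᶠ p : ℕ × H, x p.1 (e p.2)) = ∑ᶠ p : ℕ × H, x p.1 p.2 :=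
  finsum_comp_equiv (f := fun p : ℕ × H => x p.1 p.2) ((Equiv.refl ℕ).prodCongr e)

/-- Relabelling the group coordinates of a point along a bijection of `G`, given by its inverse. -/
def relabel (e : G ≃ G) (x : EG G) : EG G :=
  ⟨fun i k => x.1 i (e k), by
    refine (x.2.1.preimage (((Equiv.refl ℕ).prodCongr e).injective.injOn)), fun i g => x.2.2.1 i _,
    (finsum_relabel e x.1).trans x.2.2.2.1, fun i g h hg hh => e.injective (x.2.2.2.2 i _ _ hg hh)⟩

theorem continuous_relabel (e : G ≃ G) : Continuous (relabel (G := G) e) :=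
  continuous_induced_rng.mpr (continuous_pi fun i => continuous_pi fun k =>
    (continuous_apply (e k)).comp ((continuous_apply i).comp continuous_subtype_val))

/-- The free left action `g • ∑ᵢ tᵢ gᵢ = ∑ᵢ tᵢ (g gᵢ)`. -/
instance : MulAction G (EG G) where
  smul g x := relabel (Equiv.mulLeft g⁻¹) x
  one_smul x := Subtype.ext (funext fun i => funext fun k =>
    congrArg (x.1 i) (show (1 : G)⁻¹ * k = k by group))
  mul_smul g h x := Subtype.ext (funext fun i => funext fun k =>
    congrArg (x.1 i) (show (g * h)⁻¹ * k = h⁻¹ * (g⁻¹ * k) by group))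

theorem smul_val (g : G) (x : EG G) (i : ℕ) (k : G) : (g • x).1 i k = x.1 i (g⁻¹ * k) := rfl

/-- The map `∑ᵢ tᵢ gᵢ ↦ ∑ᵢ tᵢ (h gᵢ h⁻¹)` induced by conjugation by `h`. -/
def conj (h : G) (x : EG G) : EG G := relabel (MulAut.conj h⁻¹).toEquiv x

theorem conj_val (h : G) (x : EG G) (i : ℕ) (k : G) : (conj h x).1 i k = x.1 i (h⁻¹ * k * h) := by
  simp [conj, relabel]

theorem conj_smul (h g : G) (x : EG G) : conj h (g • x) = (h * g * h⁻¹) • conj h x :=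
  Subtype.ext (funext fun i => funext fun k => by
    rw [conj_val, smul_val, smul_val, conj_val]
    exact congrArg (x.1 i) (by group))

theorem continuous_conj (h : G) : Continuous (conj (G := G) h) := continuous_relabel _

open Classical in
/-- The base vertex `1 · 1` in the first factor of the join. -/
def base : EG G :=
  ⟨fun i k => if (i, k) = (0, 1) then 1 else 0, by
    refine (Set.finite_singleton ((0, 1) : ℕ × G)).subset fun p hp => ?_
    by_contra h
    exact hp (if_neg h), fun i g => by dsimp only; split_ifs <;> norm_num, by
    rw [finsum_eq_single _ ((0, 1) : ℕ × G) (fun p hp => if_neg hp)]; simp, by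
    intro i g h hg hh
    simp only [ne_eq, ite_eq_right_iff, one_ne_zero, imp_false, not_not, Prod.mk.injEq] at hg hh
    rw [hg.2, hh.2]⟩

open Classical in
theorem conj_base (h : G) : conj h (base : EG G) = base :=
  Subtype.ext (funext fun i => funext fun k => by
    rw [conj_val]
    have : h⁻¹ * k * h = 1 ↔ k = 1 := by
      constructor
      · intro e
        have : k = h * (h⁻¹ * k * h) * h⁻¹ := by group
        rw [this, e]; group
      · rintro rfl; group
    exact if_congr (by rw [Prod.mk.injEq, Prod.mk.injEq, this]) rfl rfl)

end EG

/-- The classifying space `BG = G \ EG`. -/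
def BG (G : Type u) [Group G] : Type u := Quotient (MulAction.orbitRel G (EG G))

namespace BG

variable {G : Type u} [Group G]

instance : TopologicalSpace (BG G) := instTopologicalSpaceQuotient

/-- The projection `EG → BG`. -/
def proj : EG G → BG G := Quotient.mk (MulAction.orbitRel G (EG G))

/-- The projection `EG → BG` is a covering map with deck group `G`. -/
theorem isQuotientCoveringMap_proj : IsQuotientCoveringMap (proj (G := G)) G where
  toIsQuotientMap := isQuotientMap_quotient_mk'
  continuous_const_smul g := EG.continuous_relabel _
  apply_eq_iff_mem_orbit := Quotient.eq
  disjoint x := by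
    have hx : ∃ i k, x.1 i k ≠ 0 := by
      by_contra! h
      have h1 := x.2.2.2.1
      simp [h] at h1
    obtain ⟨i, k, hk⟩ := hx
    refine ⟨{y | y.1 i k ≠ 0}, ?_, ?_⟩
    · refine IsOpen.mem_nhds ?_ hk
      exact isOpen_ne.preimage
        ((continuous_apply k).comp ((continuous_apply i).comp continuous_subtype_val))
    · rintro g ⟨_, ⟨y, hy, rfl⟩, hgy⟩
      have h1 := y.2.2.2.2 i _ _ hy (show y.1 i (g⁻¹ * k) ≠ 0 from hgy)
      have h2 : g⁻¹ = 1 := by simpa using h1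
      simpa using h2

theorem proj_smul (g : G) (x : EG G) : proj (g • x) = proj x := Quotient.sound ⟨g, rfl⟩

/-- The basepoint of `BG`. -/
def base : BG G := proj EG.base

/-- The self-map of `BG` induced by the automorphism `k ↦ h k h⁻¹` of `G`. -/
def conj (h : G) : BG G → BG G :=
  Quotient.map' (EG.conj h) (by
    rintro _ y ⟨g, rfl⟩
    exact ⟨h * g * h⁻¹, (EG.conj_smul h g y).symm⟩)

theorem conj_proj (h : G) (x : EG G) : conj h (proj x) = proj (EG.conj h x) := rfl

theorem continuous_conj (h : G) : Continuous (conj (G := G) h) :=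
  Continuous.quotient_map' (EG.continuous_conj h) _

theorem conj_base (h : G) : conj h (base : BG G) = base :=
  congrArg proj (EG.conj_base h)

theorem existsUnique_loopClass (γ : Path (base : BG G) base) :
    ∃! g : G, ∃ l : C(I, EG G), (∀ s, proj (l s) = γ s) ∧ l 0 = EG.base ∧ l 1 = g • EG.base := by
  have q := isQuotientCoveringMap_proj (G := G)
  have cov := q.isCoveringMap
  have h0 : (γ : C(I, BG G)) 0 = proj EG.base := γ.source
  have hl := cov.liftPath_lifts γ EG.base h0
  have h1 : proj (cov.liftPath γ EG.base h0 1) = proj (EG.base : EG G) :=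
    (congrFun hl 1).trans γ.target
  obtain ⟨g, hg⟩ := q.apply_eq_iff_mem_orbit.mp h1
  refine ⟨g, ⟨cov.liftPath γ EG.base h0, fun s => congrFun hl s, cov.liftPath_zero γ _ h0,
    hg.symm⟩, ?_⟩
  rintro g' ⟨l, hl1, hl2, hl3⟩
  have e : l = cov.liftPath γ EG.base h0 :=
    (cov.eq_liftPath_iff' h0).mpr ⟨funext hl1, hl2⟩
  have := q.isCancelSMul
  refine IsCancelSMul.right_cancel g' g (EG.base : EG G) ?_
  rw [← hl3, e]; exact hg.symm

/-- The identification `π₁(BG, base) ≅ G`: a based loop represents the unique `g` such that its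
lift to `EG` starting at the base vertex ends at `g` times the base vertex. Concatenation (first
loop first) corresponds to the product of `G`. -/
def loopClass (γ : Path (base : BG G) base) : G := (existsUnique_loopClass γ).choose

/-- A closed path `γ` in `BG`, not necessarily based, represents an element of the
conjugation-invariant subset `c` of `G`: some lift of `γ` to `EG` ends at the translate of its
starting point by an element of `c`. -/
def LoopIn (c : Set G) (γ : I → BG G) : Prop :=
  ∃ g ∈ c, ∃ l : C(I, EG G), (∀ s, proj (l s) = γ s) ∧ l 1 = g • l 0

theorem LoopIn.conj {c : Set G} {γ : I → BG G}
    (hγ : LoopIn c γ) (h : G) : LoopIn c (fun s => BG.conj h (γ s)) := by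
  obtain ⟨g, hg, l, hl, hl1⟩ := hγ
  refine ⟨g, hg, ⟨fun s => h⁻¹ • EG.conj h (l s),
    (EG.continuous_relabel _).comp ((EG.continuous_conj h).comp l.continuous)⟩, fun s => ?_, ?_⟩
  · change proj (h⁻¹ • EG.conj h (l s)) = BG.conj h (γ s)
    rw [← hl s, conj_proj]; exact proj_smul _ _
  · change h⁻¹ • EG.conj h (l 1) = g • h⁻¹ • EG.conj h (l 0)
    rw [hl1, EG.conj_smul, smul_smul, smul_smul]
    congr 1; group

end BG

/-! ### Configurations -/

/-- The space of configurations of `n` distinct unordered points of the plane. -/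
def Conf (n : ℕ) : Type := {ξ : Finset (ℝ × ℝ) // ξ.card = n}

/-- The quotient topology from ordered configurations of distinct points. -/
instance (n : ℕ) : TopologicalSpace (Conf n) :=
  TopologicalSpace.coinduced
    (fun x : {x : Fin n → ℝ × ℝ // Function.Injective x} =>
      (⟨Finset.univ.map ⟨x.1, x.2⟩, by simp⟩ : Conf n)) inferInstance

/-- The rectangle `[0, t] × [0, 1]`. -/
def rect (t : ℝ) : Set (ℝ × ℝ) := Icc 0 t ×ˢ Icc 0 1

/-- The part `({0, t} × [0, 1]) ∪ ([0, t] × {0})` of the boundary of the rectangle. -/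
def sqcup (t : ℝ) : Set (ℝ × ℝ) := ({0, t} ×ˢ Icc 0 1) ∪ (Icc 0 t ×ˢ {0})

/-- The circle of radius `r` around `p`, traversed once clockwise. -/
def smallLoop (p : ℝ × ℝ) (r : ℝ) (s : I) : ℝ × ℝ :=
  (p.1 + r * Real.cos (2 * Real.pi * s), p.2 - r * Real.sin (2 * Real.pi * s))

theorem smallLoop_fst_le (p : ℝ × ℝ) {r : ℝ} (hr : 0 < r) (s : I) :
    |(smallLoop p r s).1 - p.1| ≤ r := by
  simp only [smallLoop, add_sub_cancel_left, abs_mul, abs_of_pos hr]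
  exact mul_le_of_le_one_right hr.le (Real.abs_cos_le_one _)

/-- The translation `p ↦ p + (t, 0)`. -/
def shift (t : ℝ) : ℝ × ℝ ↪ ℝ × ℝ := addRightEmbedding (t, 0)

/-! ### The spaces of marked branched covers -/

/-- Tuples `(t, ξ, f)` with `ξ` a set of `n` points of `(0, t) × (0, 1)` and
`f : [0, t] × [0, 1] \ ξ → BG` a continuous map that sends `sqcup t` to the basepoint and a small
loop around each point of `ξ` to a loop representing an element of `c`. The map `f` is recorded as
a function on the plane that takes the value `base` off its domain of definition. Small loops are
clockwise, so that the class of `f` on the edge `[0, t] × {1}`, traversed in the direction of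
increasing first coordinate, is the product of the local monodromies. -/
@[ext]
structure HurN (G : Type u) [Group G] (c : Set G) (n : ℕ) where
  t : ℝ
  ξ : Finset (ℝ × ℝ)
  f : ℝ × ℝ → BG G
  t_pos : 0 < t
  card_ξ : ξ.card = n
  ξ_mem : ∀ p ∈ ξ, p ∈ Ioo 0 t ×ˢ Ioo (0 : ℝ) 1
  f_cont : ContinuousOn f (rect t \ ξ)
  f_off : ∀ p, p ∉ rect t \ ξ → f p = BG.base
  f_sqcup : ∀ p ∈ sqcup t, f p = BG.base
  f_loop : ∀ p ∈ ξ, ∀ᶠ r in 𝓝[>] (0 : ℝ), BG.LoopIn c (fun s => f (smallLoop p r s))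

namespace HurN

variable {G : Type u} [Group G] {c : Set G} {n m : ℕ}

/-- The forgetful map `(t, ξ, f) ↦ (t, ξ)`. -/
def toConf (a : HurN G c n) : ℝ × Conf n := (a.t, ⟨a.ξ, a.card_ξ⟩)

/-- The fibrewise compact-open topology: the coarsest one for which `(t, ξ)` depends continuously
on `(t, ξ, f)`, and for which, for `K` compact in the plane and `U` open in `BG`, the set of those
`(t, ξ, f)` with `K ∩ ξ = ∅` and `f (K ∩ [0, t] × [0, 1]) ⊆ U` is open. -/
instance : TopologicalSpace (HurN G c n) :=
  TopologicalSpace.induced toConf inferInstance ⊓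
    TopologicalSpace.generateFrom {W | ∃ (K : Set (ℝ × ℝ)) (U : Set (BG G)),
      IsCompact K ∧ IsOpen U ∧
        W = {a | Disjoint K (a.ξ : Set (ℝ × ℝ)) ∧ MapsTo a.f (K ∩ rect a.t) U}}

theorem f_eq_base_of_left (a : HurN G c n) {p : ℝ × ℝ} (hp : p.1 ≤ 0) : a.f p = BG.base := by
  by_cases h : p ∈ rect a.t \ a.ξ
  · exact a.f_sqcup p (Or.inl ⟨Or.inl (le_antisymm hp h.1.1.1), h.1.2⟩)
  · exact a.f_off p h

theorem f_eq_base_of_right (a : HurN G c n) {p : ℝ × ℝ} (hp : a.t ≤ p.1) : a.f p = BG.base := by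
  by_cases h : p ∈ rect a.t \ a.ξ
  · exact a.f_sqcup p (Or.inl ⟨Or.inr (le_antisymm h.1.1.2 hp), h.1.2⟩)
  · exact a.f_off p h

/-- The product `(t, ξ, f) · (t', ξ', f') = (t + t', ξ ⊔ (ξ' + (t, 0)), f'')`, where `f''` is `f`
for `x ≤ t` and `f' (x - t, y)` for `x ≥ t`. -/
def mul (a : HurN G c n) (b : HurN G c m) : HurN G c (n + m) where
  t := a.t + b.t
  ξ := a.ξ ∪ b.ξ.map (shift a.t)
  f p := if p.1 ≤ a.t then a.f p else b.f (p.1 - a.t, p.2)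
  t_pos := add_pos a.t_pos b.t_pos
  card_ξ := by
    rw [Finset.card_union_of_disjoint, Finset.card_map, a.card_ξ, b.card_ξ]
    rw [Finset.disjoint_left]
    intro p hp hp'
    obtain ⟨q, hq, rfl⟩ := Finset.mem_map.mp hp'
    have h1 := (a.ξ_mem _ hp).1.2
    have h2 := (b.ξ_mem _ hq).1.1
    simp only [shift, addRightEmbedding_apply, Prod.fst_add] at h1
    linarith
  ξ_mem := by
    intro p hp
    rcases Finset.mem_union.mp hp with hp | hp
    · obtain ⟨h1, h2⟩ := a.ξ_mem _ hp
      exact ⟨⟨h1.1, by linarith [h1.2, b.t_pos]⟩, h2⟩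
    · obtain ⟨q, hq, rfl⟩ := Finset.mem_map.mp hp
      obtain ⟨h1, h2⟩ := b.ξ_mem _ hq
      refine ⟨⟨?_, ?_⟩, ?_⟩
      · simp only [shift, addRightEmbedding_apply, Prod.fst_add]; linarith [h1.1, a.t_pos]
      · simp only [shift, addRightEmbedding_apply, Prod.fst_add]; linarith [h1.2]
      · simpa [shift] using h2
  f_cont := by
    have hl : closure {p : ℝ × ℝ | p.1 ≤ a.t} = {p : ℝ × ℝ | p.1 ≤ a.t} :=
      (isClosed_le continuous_fst continuous_const).closure_eq
    have hr : closure {p : ℝ × ℝ | ¬ p.1 ≤ a.t} ⊆ {p : ℝ × ℝ | a.t ≤ p.1} :=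
      closure_minimal (fun p hp => (not_le.mp hp).le) (isClosed_le continuous_const continuous_fst)
    refine ContinuousOn.if ?_ ?_ ?_
    · rintro p ⟨-, hp⟩
      have hp : p.1 = a.t :=
        frontier_le_subset_eq continuous_fst continuous_const hp
      rw [a.f_eq_base_of_right hp.ge, b.f_eq_base_of_left (by simp [hp])]
    · rw [hl]
      refine a.f_cont.mono ?_
      rintro p ⟨⟨⟨h1, h2⟩, h3⟩, h4⟩
      exact ⟨⟨⟨h1.1, h4⟩, h2⟩, fun h => h3 (by simp [Finset.mem_coe.mp h])⟩
    · refine b.f_cont.comp (by fun_prop) ?_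
      rintro p ⟨⟨⟨h1, h2⟩, h3⟩, h4⟩
      have h4 := hr h4
      refine ⟨⟨⟨sub_nonneg.mpr h4, ?_⟩, h2⟩, fun h => h3 ?_⟩
      · linarith [h1.2]
      · refine Finset.mem_coe.mpr (Finset.mem_union_right _ (Finset.mem_map.mpr ⟨_, h, ?_⟩))
        simp [shift]
  f_off := by
    intro p hp
    split_ifs with h
    · refine a.f_off p fun h' => hp ⟨⟨⟨h'.1.1.1, by linarith [b.t_pos]⟩, h'.1.2⟩, fun h3 => ?_⟩
      rcases Finset.mem_union.mp (Finset.mem_coe.mp h3) with h3 | h3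
      · exact h'.2 h3
      · obtain ⟨q, hq, rfl⟩ := Finset.mem_map.mp h3
        have h2 := (b.ξ_mem _ hq).1.1
        simp only [shift, addRightEmbedding_apply, Prod.fst_add] at h
        linarith
    · refine b.f_off _ fun h' => hp ⟨⟨⟨?_, ?_⟩, h'.1.2⟩, fun h3 => ?_⟩
      · linarith [a.t_pos]
      · linarith [h'.1.1.2]
      · rcases Finset.mem_union.mp (Finset.mem_coe.mp h3) with h3 | h3
        · exact h (a.ξ_mem _ h3).1.2.le
        · obtain ⟨q, hq, rfl⟩ := Finset.mem_map.mp h3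
          exact h'.2 (by simpa [shift] using hq)
  f_sqcup := by
    rintro p (⟨h1 | h1, h2⟩ | ⟨h1, h2⟩)
    · rw [if_pos (by rw [h1]; exact a.t_pos.le)]
      exact a.f_eq_base_of_left h1.le
    · have h1 : p.1 = a.t + b.t := h1
      rw [if_neg (by rw [h1]; linarith [b.t_pos])]
      exact b.f_eq_base_of_right (by simp [h1])
    · split_ifs with h
      · exact a.f_sqcup _ (Or.inr ⟨⟨h1.1, h⟩, h2⟩)
      · exact b.f_sqcup _ (Or.inr ⟨⟨by simpa using (not_le.mp h).le, by
          simpa [sub_le_iff_le_add, add_comm] using h1.2⟩, h2⟩)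
  f_loop := by
    intro p hp
    rcases Finset.mem_union.mp hp with hp | hp
    · have h1 := (a.ξ_mem _ hp).1.2
      filter_upwards [a.f_loop p hp, Ioo_mem_nhdsGT (sub_pos.mpr h1)] with r hr hr'
      convert! hr using 2 with s
      have := abs_le.mp (smallLoop_fst_le p hr'.1 s)
      rw [if_pos (by linarith [hr'.2])]
    · obtain ⟨q, hq, rfl⟩ := Finset.mem_map.mp hp
      have h1 := (b.ξ_mem _ hq).1.1
      filter_upwards [b.f_loop q hq, Ioo_mem_nhdsGT h1] with r hr hr'
      convert! hr using 2 with s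
      have := abs_le.mp (smallLoop_fst_le (shift a.t q) hr'.1 s)
      have h2 : (shift a.t q).1 = q.1 + a.t := rfl
      rw [if_neg (by linarith [hr'.2])]
      congr 1
      ext <;> simp [smallLoop, shift]
      ring

/-- The action of `h ∈ G` by postcomposition of `f` with the self-map of `BG` induced by
conjugation by `h`. -/
def conjAct (h : G) (a : HurN G c n) : HurN G c n where
  t := a.t
  ξ := a.ξ
  f p := BG.conj h (a.f p)
  t_pos := a.t_pos
  card_ξ := a.card_ξ
  ξ_mem := a.ξ_mem
  f_cont := (BG.continuous_conj h).comp_continuousOn a.f_cont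
  f_off p hp := by rw [a.f_off p hp, BG.conj_base]
  f_sqcup p hp := by rw [a.f_sqcup p hp, BG.conj_base]
  f_loop p hp := (a.f_loop p hp).mono fun _ hr => hr.conj h

/-- The loop in `BG` given by the restriction of `f` to the edge `[0, t] × {1}`. -/
def topLoop (a : HurN G c n) : Path (BG.base : BG G) BG.base where
  toFun s := a.f (s * a.t, 1)
  continuous_toFun := by
    refine a.f_cont.comp_continuous (by fun_prop) fun s => ⟨⟨⟨?_, ?_⟩, ?_⟩, fun h => ?_⟩
    · exact mul_nonneg s.2.1 a.t_pos.le
    · exact mul_le_of_le_one_left a.t_pos.le s.2.2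
    · simp
    · exact lt_irrefl _ (a.ξ_mem _ h).2.2
  source' := a.f_eq_base_of_left (by simp)
  target' := a.f_eq_base_of_right (by simp)

/-- The global monodromy: the class in `π₁(BG) = G` of `f` restricted to `[0, t] × {1}`. -/
def μ (a : HurN G c n) : G := BG.loopClass a.topLoop

end HurN

/-- The disjoint union of the spaces `HurN G c n` over `n ≥ 0`, where the space for `n = 0` is a
single point (the unit). -/
def Hur (G : Type u) [Group G] (c : Set G) : Type u := Unit ⊕ (Σ n : ℕ+, HurN G c n)

namespace Hur

variable {G : Type u} [Group G] {c : Set G}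

instance : TopologicalSpace (Hur G c) :=
  inferInstanceAs (TopologicalSpace (Unit ⊕ (Σ n : ℕ+, HurN G c n)))

/-- The unit is the point for `n = 0`. -/
instance : One (Hur G c) := ⟨Sum.inl ()⟩

instance : Mul (Hur G c) where
  mul
    | Sum.inl _, b => b
    | Sum.inr a, Sum.inl _ => Sum.inr a
    | Sum.inr ⟨n, a⟩, Sum.inr ⟨m, b⟩ => Sum.inr ⟨n + m, a.mul b⟩

/-- The action `*` of `G`, induced by the conjugation action of `G` on itself. -/
instance : SMul G (Hur G c) where
  smul
    | _, Sum.inl _ => Sum.inl ()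
    | h, Sum.inr ⟨n, a⟩ => Sum.inr ⟨n, a.conjAct h⟩

/-- The global monodromy. -/
def μ : Hur G c → G
  | Sum.inl _ => 1
  | Sum.inr ⟨_, a⟩ => a.μ

end Hur

/-! ### Multiplication by path components on homology -/

/-- The singular homology `H_*(X; k)` in all degrees. -/
abbrev TotalHomology (k : Type u) [Field k] (X : Type u) [TopologicalSpace X] : Type u :=
  ⨁ d : ℕ, (((AlgebraicTopology.singularHomologyFunctor (ModuleCat.{u} k) d).obj
    (ModuleCat.of k k)).obj (TopCat.of X) : ModuleCat.{u} k)

/-- The map induced by a continuous map on singular homology. -/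
def homologyMap (k : Type u) [Field k] {X Y : Type u} [TopologicalSpace X] [TopologicalSpace Y]
    (φ : C(X, Y)) : TotalHomology k X →ₗ[k] TotalHomology k Y :=
  DirectSum.lmap fun d => (((AlgebraicTopology.singularHomologyFunctor (ModuleCat.{u} k) d).obj
    (ModuleCat.of k k)).map (TopCat.ofHom φ)).hom

/-- For a continuous multiplication `m` on `X`, the left product `r ↦ [a] · r` in `H_*(X; k)` with
the class `[a] ∈ H_0(X; k)` of the path component of `a`. It is induced by `x ↦ m (a, x)`. -/
def leftMulPoint (k : Type u) [Field k] {X : Type u} [TopologicalSpace X] (m : C(X × X, X))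
    (a : X) : TotalHomology k X →ₗ[k] TotalHomology k X :=
  homologyMap k (m.comp ((ContinuousMap.const X a).prodMk (ContinuousMap.id X)))

/-- For a continuous multiplication `m` on `X`, the right product `r ↦ r · [a]` in `H_*(X; k)` with
the class `[a] ∈ H_0(X; k)` of the path component of `a`. It is induced by `x ↦ m (x, a)`. -/
def rightMulPoint (k : Type u) [Field k] {X : Type u} [TopologicalSpace X] (m : C(X × X, X))
    (a : X) : TotalHomology k X →ₗ[k] TotalHomology k X :=
  homologyMap k (m.comp ((ContinuousMap.id X).prodMk (ContinuousMap.const X a)))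

end

/-! The homotopy is the braiding of two rectangles. Shrink `a` and `b` by a factor 2, with `a` at
the bottom and `b` at the top of the strip, slide `b` to the left above `a` until it has passed it,
and enlarge both again. Above its upper edge the map of `a` is extended constantly in the vertical
direction, so it is not the basepoint there and the map of `b` cannot simply be pasted in. It has to
be changed along the loop that the upper edge of `a` describes in `BG`, and on the far left this
change has to be conjugation by `μ a`.

To make the change strict and continuous, points of `EG` are viewed as `G`-valued step functions on
`[0, 1]` and multiplied pointwise (`EG.mul`). This commutes with the left action of `G`, so `EG`
multiplies `BG` from the right (`BG.act`). The basepoint times `y` is the image of `y`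
(`BG.act_base`), and multiplication by `g⁻¹ • base` is conjugation by `g` (`BG.act_smul_base`). The
upper edge of `a` lifts to a path `roof` in `EG` from `μ⁻¹ • base` to `base`. On and above the
rectangle of `b` the slide is the map of `b` times `roof`. Where `b` is at the basepoint this is the
image of `roof`, that is, the extended map of `a`, so the pieces glue (`HurN.fext_toLower`,
`HurN.slideMap_of_or`). To the right of `a` the factor is `base` and the result is `a · b`. To the
left it is `μ⁻¹ • base` and the result is `(μ(a) * b) · a`. Local monodromies stay in `c` because
multiplying by a closed path of `EG` does not change the class of a loop (`BG.LoopIn.act`).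

In homology the homotopy gives `[a] · r = (μ(a) * r) · [a]`. Both fraction conditions follow, since
`G` acts invertibly and compatibly with the product. -/

noncomputable section

/-! ### A multiplication on the infinite join -/

/-- The length of `[a, b] ∩ [c, d]` for `a ≤ b` and `c ≤ d`. -/
def overlap (a b c d : ℝ) : ℝ := min (max d a) b - min (max c a) b

theorem overlap_nonneg {c d : ℝ} (a b : ℝ) (h : c ≤ d) : 0 ≤ overlap a b c d :=
  sub_nonneg.mpr (min_le_min_right _ (max_le_max_right _ h))

theorem overlap_self_right (a b c : ℝ) : overlap a b c c = 0 := sub_self _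

theorem overlap_self_left (a c d : ℝ) : overlap a a c d = 0 := by
  simp [overlap]

theorem lt_of_overlap_ne_zero {a b c d : ℝ} (hcd : c ≤ d) (h : overlap a b c d ≠ 0) :
    a < d ∧ c < b := by
  constructor
  · by_contra! h'
    exact h (by rw [overlap, max_eq_right h', max_eq_right (hcd.trans h'), sub_self])
  · by_contra! h'
    exact h (by rw [overlap, min_eq_right (le_max_of_le_left h'),
      min_eq_right (le_max_of_le_left (h'.trans hcd)), sub_self])

namespace EG

variable {G : Type u} [Group G]

/-- The total weight of the `i`-th coordinate. -/
def weight (x : EG G) (i : ℕ) : ℝ := ∑ᶠ g, x.1 i g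

open Classical in
/-- The group coordinate at index `i` (and `1` if the weight vanishes). -/
def label (x : EG G) (i : ℕ) : G := if h : ∃ g, x.1 i g ≠ 0 then h.choose else 1

theorem label_eq {x : EG G} {i : ℕ} {g : G} (h : x.1 i g ≠ 0) : x.label i = g := by
  have h' : ∃ g, x.1 i g ≠ 0 := ⟨g, h⟩
  rw [label, dif_pos h']
  exact x.2.2.2.2 i _ _ h'.choose_spec h

theorem val_eq_zero_of_ne {x : EG G} {i : ℕ} {g : G} (h : g ≠ x.label i) : x.1 i g = 0 := by
  by_contra h'
  exact h (label_eq h').symm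

theorem val_label (x : EG G) (i : ℕ) : x.1 i (x.label i) = x.weight i :=
  (finsum_eq_single (x.1 i) _ fun _ h => val_eq_zero_of_ne h).symm

theorem weight_nonneg (x : EG G) (i : ℕ) : 0 ≤ x.weight i := x.val_label i ▸ x.2.2.1 i _

open Classical in
theorem val_eq (x : EG G) (i : ℕ) (g : G) :
    x.1 i g = if g = x.label i then x.weight i else 0 := by
  split_ifs with h
  · rw [h, val_label]
  · exact val_eq_zero_of_ne h

theorem finite_support_weight (x : EG G) : (Function.support x.weight).Finite :=
  (x.2.1.image Prod.fst).subset fun i hi => ⟨(i, x.label i), by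
    rw [mem_ofPred_eq, val_label]; exact hi, rfl⟩

theorem exists_weight_eq_zero (x : EG G) : ∃ N, ∀ i, N ≤ i → x.weight i = 0 := by
  obtain ⟨N, hN⟩ := x.finite_support_weight.bddAbove
  refine ⟨N + 1, fun i hi => ?_⟩
  by_contra h
  exact absurd (hN h) (by omega)

theorem finsum_weight (x : EG G) : ∑ᶠ i, x.weight i = 1 := by
  rw [← x.2.2.2.1, finsum_curry _ x.2.1]
  rfl

/-- The partial sums of the weights. -/
def psum (x : EG G) (i : ℕ) : ℝ := ∑ j ∈ Finset.range i, x.weight j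

theorem psum_zero (x : EG G) : x.psum 0 = 0 := Finset.sum_range_zero _

theorem psum_succ (x : EG G) (i : ℕ) : x.psum (i + 1) = x.psum i + x.weight i :=
  Finset.sum_range_succ _ _

theorem psum_mono (x : EG G) : Monotone x.psum :=
  monotone_nat_of_le_succ fun i => by rw [psum_succ]; linarith [x.weight_nonneg i]

theorem psum_nonneg (x : EG G) (i : ℕ) : 0 ≤ x.psum i :=
  Finset.sum_nonneg fun _ _ => x.weight_nonneg _

theorem exists_psum_eq_one (x : EG G) :
    ∃ N, (∀ i, N ≤ i → x.weight i = 0) ∧ ∀ i, N ≤ i → x.psum i = 1 := by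
  obtain ⟨N, hN⟩ := x.exists_weight_eq_zero
  refine ⟨N, hN, fun i hi => ?_⟩
  rw [← x.finsum_weight, psum, finsum_eq_sum_of_support_subset]
  intro j hj
  by_contra h
  exact hj (hN j (hi.trans (by simpa using h)))

theorem psum_le_one (x : EG G) (i : ℕ) : x.psum i ≤ 1 := by
  obtain ⟨N, -, hN⟩ := x.exists_psum_eq_one
  exact (x.psum_mono (le_max_left i N)).trans_eq (hN _ (le_max_right i N))

/-- If the weights of `x` and `y` cut `[0, 1]` into consecutive intervals, this is the length of
the intersection of the interval `i` of `x` with the interval `j` of `y`. -/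
def common (x y : EG G) (p : ℕ × ℕ) : ℝ :=
  overlap (x.psum p.1) (x.psum (p.1 + 1)) (y.psum p.2) (y.psum (p.2 + 1))

theorem common_nonneg (x y : EG G) (p : ℕ × ℕ) : 0 ≤ common x y p :=
  overlap_nonneg _ _ (y.psum_mono p.2.le_succ)

theorem weight_ne_zero_left {x y : EG G} {p : ℕ × ℕ} (h : common x y p ≠ 0) : x.weight p.1 ≠ 0 :=
  fun h' => h (by rw [common, psum_succ, h', add_zero, overlap_self_left])

theorem weight_ne_zero_right {x y : EG G} {p : ℕ × ℕ} (h : common x y p ≠ 0) : y.weight p.2 ≠ 0 :=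
  fun h' => h (by rw [common, y.psum_succ, h', add_zero, overlap_self_right])

/-- The pairs of overlapping intervals form a monotone staircase: increasing one index while
decreasing the other would reverse the order of two intervals on the line. Hence each antidiagonal
meets the staircase at most once, and indexing by `i + j` gives the product at most one group
coordinate per index. -/
theorem common_eq_of_add_eq {x y : EG G} {p q : ℕ × ℕ} (hp : common x y p ≠ 0)
    (hq : common x y q ≠ 0) (h : p.1 + p.2 = q.1 + q.2) : p = q := by
  have key : ∀ {p q : ℕ × ℕ}, common x y p ≠ 0 → common x y q ≠ 0 → p.1 + p.2 = q.1 + q.2 →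
      ¬ p.1 < q.1 := by
    intro p q hp hq h hlt
    have h1 := (lt_of_overlap_ne_zero (y.psum_mono p.2.le_succ) hp).2
    have h2 := (lt_of_overlap_ne_zero (y.psum_mono q.2.le_succ) hq).1
    have h3 : x.psum (p.1 + 1) ≤ x.psum q.1 := x.psum_mono hlt
    have h4 : y.psum (q.2 + 1) ≤ y.psum p.2 := y.psum_mono (by omega)
    linarith
  have h1 : p.1 = q.1 := le_antisymm (not_lt.mp (key hq hp h.symm)) (not_lt.mp (key hp hq h))
  exact Prod.ext h1 (by omega)

/-- Overlap is a difference of truncations, so the sum telescopes over the intervals of `y`, then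
over those of `x`. -/
theorem sum_common (x y : EG G) (N : ℕ) (hx : x.psum N = 1) (hy : y.psum N = 1) :
    ∑ p ∈ Finset.range N ×ˢ Finset.range N, common x y p = 1 := by
  rw [Finset.sum_product]
  have : ∀ i, ∑ j ∈ Finset.range N, common x y (i, j) = x.psum (i + 1) - x.psum i := by
    intro i
    simp only [common, overlap]
    rw [Finset.sum_range_sub (fun j => min (max (y.psum j) (x.psum i)) (x.psum (i + 1))), hy,
      psum_zero, max_eq_left (x.psum_le_one i), max_eq_right (x.psum_nonneg i),
      min_eq_right (x.psum_le_one _), min_eq_left (x.psum_mono i.le_succ)]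
  simp only [this]
  rw [Finset.sum_range_sub, hx, psum_zero, sub_zero]

open Classical in
/-- The weights of the product of `x` and `y`. -/
def mulVal (x y : EG G) (n : ℕ) (l : G) : ℝ :=
  ∑ p ∈ Finset.HasAntidiagonal.antidiagonal n,
    if l = x.label p.1 * y.label p.2 then common x y p else 0

theorem mulVal_ne_zero {x y : EG G} {n : ℕ} {l : G} (h : mulVal x y n l ≠ 0) :
    ∃ p : ℕ × ℕ, p.1 + p.2 = n ∧ l = x.label p.1 * y.label p.2 ∧ common x y p ≠ 0 := by
  classical
  obtain ⟨p, hp, h⟩ := Finset.exists_ne_zero_of_sum_ne_zero h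
  rw [ne_eq, ite_eq_right_iff, Classical.not_imp] at h
  exact ⟨p, Finset.HasAntidiagonal.mem_antidiagonal.mp hp, h⟩

open Classical in
-- An index set independent of `q` allows the sums over `p` and `q` to be interchanged when the
-- total weight of the product is computed.
theorem mulVal_eq_sum {x y : EG G} {N : ℕ} (hx : ∀ i, N ≤ i → x.weight i = 0)
    (hy : ∀ i, N ≤ i → y.weight i = 0) (q : ℕ × G) :
    mulVal x y q.1 q.2 = ∑ p ∈ Finset.range N ×ˢ Finset.range N,
      if q = (p.1 + p.2, x.label p.1 * y.label p.2) then common x y p else 0 := by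
  have h0 : ∀ p : ℕ × ℕ, p ∉ Finset.range N ×ˢ Finset.range N → common x y p = 0 := by
    intro p hp
    by_contra h
    refine hp (Finset.mem_product.mpr ⟨?_, ?_⟩)
    · by_contra h'
      exact weight_ne_zero_left h (hx _ (by simpa using h'))
    · by_contra h'
      exact weight_ne_zero_right h (hy _ (by simpa using h'))
  have h1 : ∀ s : Finset (ℕ × ℕ), (∀ p ∉ s, p.1 + p.2 = q.1 → common x y p = 0) →
      ∑ᶠ p : ℕ × ℕ, (if q = (p.1 + p.2, x.label p.1 * y.label p.2) then common x y p else 0) =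
      ∑ p ∈ s, if q = (p.1 + p.2, x.label p.1 * y.label p.2) then common x y p else 0 := by
    intro s hs
    refine finsum_eq_sum_of_support_subset _ fun p hp => ?_
    by_contra h
    refine hp ?_
    dsimp only
    split_ifs with h'
    · exact hs p h (by rw [h'])
    · rfl
  rw [← h1 _ fun p hp _ => h0 p hp, h1 (Finset.HasAntidiagonal.antidiagonal q.1) fun p hp hp' =>
    absurd (Finset.HasAntidiagonal.mem_antidiagonal.mpr hp') hp, mulVal]
  refine Finset.sum_congr rfl fun p hp => ?_
  rw [Finset.HasAntidiagonal.mem_antidiagonal] at hp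
  exact if_congr (by rw [Prod.ext_iff]; simp [hp]) rfl rfl

/-- The product of two points of the infinite join: regarding points as `G`-valued step functions
on `[0, 1]`, with values `gᵢ` on consecutive intervals of lengths `tᵢ`, it is the pointwise
product. The intersection of the intervals with indices `i` and `j` gets the index `i + j`. -/
def mul (x y : EG G) : EG G :=
  ⟨mulVal x y, by
    refine ((x.finite_support_weight.prod y.finite_support_weight).image
      fun p : ℕ × ℕ => (p.1 + p.2, x.label p.1 * y.label p.2)).subset ?_
    rintro ⟨n, l⟩ h
    obtain ⟨p, hp, hl, h⟩ := mulVal_ne_zero h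
    exact ⟨p, ⟨weight_ne_zero_left h, weight_ne_zero_right h⟩, Prod.ext hp hl.symm⟩, by
    intro n l
    refine Finset.sum_nonneg fun p _ => ?_
    split_ifs
    exacts [common_nonneg _ _ _, le_rfl], by
    classical
    obtain ⟨N, hN, hN'⟩ := x.exists_psum_eq_one
    obtain ⟨M, hM, hM'⟩ := y.exists_psum_eq_one
    rw [finsum_congr (mulVal_eq_sum (N := max N M) (fun i hi => hN i ((le_max_left _ _).trans hi))
      (fun i hi => hM i ((le_max_right _ _).trans hi))), finsum_sum_comm]
    · rw [← sum_common x y (max N M) (hN' _ (le_max_left _ _)) (hM' _ (le_max_right _ _))]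
      refine Finset.sum_congr rfl fun p _ => ?_
      rw [finsum_eq_single _ (p.1 + p.2, x.label p.1 * y.label p.2) fun q hq => if_neg hq,
        if_pos rfl]
    · intro p _
      refine (Set.finite_singleton (p.1 + p.2, x.label p.1 * y.label p.2)).subset fun q hq => ?_
      by_contra h
      exact hq (if_neg h), by
    intro n l l' h h'
    obtain ⟨p, hp, hl, h⟩ := mulVal_ne_zero h
    obtain ⟨p', hp', hl', h'⟩ := mulVal_ne_zero h'
    obtain rfl := common_eq_of_add_eq h h' (hp.trans hp'.symm)
    rw [hl, hl']⟩

theorem weight_smul (g : G) (x : EG G) (i : ℕ) : (g • x).weight i = x.weight i :=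
  finsum_comp_equiv (f := fun k => x.1 i k) (Equiv.mulLeft g⁻¹)

theorem psum_smul (g : G) (x : EG G) (i : ℕ) : (g • x).psum i = x.psum i :=
  Finset.sum_congr rfl fun _ _ => weight_smul _ _ _

theorem label_smul (g : G) {x : EG G} {i : ℕ} (h : x.weight i ≠ 0) :
    (g • x).label i = g * x.label i :=
  label_eq (by rw [smul_val, inv_mul_cancel_left, val_label]; exact h)

theorem smul_mul (g : G) (x y : EG G) : mul (g • x) y = g • mul x y := by
  classical
  refine Subtype.ext (funext fun n => funext fun l => ?_)
  rw [smul_val]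
  change mulVal _ _ _ _ = mulVal _ _ _ _
  refine Finset.sum_congr rfl fun p _ => ?_
  have hc : common (g • x) y p = common x y p := by simp only [common, psum_smul]
  rw [hc]
  -- The label is the default `1` where the weight vanishes and is not equivariant there, but such
  -- terms have coefficient `0`.
  by_cases h : common x y p = 0
  · simp [h]
  · rw [label_smul g (weight_ne_zero_left h)]
    exact if_congr (by rw [inv_mul_eq_iff_eq_mul, mul_assoc]) rfl rfl

theorem val_smul_base (g : G) : (g • (base : EG G)).1 0 g = 1 := by
  rw [smul_val]; simp [base]

theorem label_smul_base (g : G) : (g • (base : EG G)).label 0 = g :=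
  label_eq (by rw [val_smul_base]; exact one_ne_zero)

theorem weight_smul_base (g : G) : (g • (base : EG G)).weight 0 = 1 := by
  rw [← val_label, label_smul_base, val_smul_base]

theorem psum_smul_base (g : G) (i : ℕ) : (g • (base : EG G)).psum (i + 1) = 1 :=
  le_antisymm (psum_le_one _ _) (by
    rw [← weight_smul_base g, ← zero_add (weight _ 0), ← psum_zero (g • (base : EG G)), ← psum_succ]
    exact psum_mono _ (by omega))

theorem base_mul (y : EG G) : mul base y = y := by
  classical
  have hb : (base : EG G) = (1 : G) • base := (one_smul _ _).symm
  refine Subtype.ext (funext fun n => funext fun l => ?_)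
  change mulVal _ _ _ _ = _
  rw [mulVal, Finset.sum_eq_single (0, n), val_eq]
  · have : common base y (0, n) = y.weight n := by
      rw [common, hb, psum_smul_base, psum_zero, overlap, max_eq_left (psum_nonneg _ _),
        max_eq_left (psum_nonneg _ _), min_eq_left (psum_le_one _ _), min_eq_left (psum_le_one _ _),
        psum_succ, add_sub_cancel_left]
    rw [this, hb, label_smul_base, one_mul]
  · rintro ⟨i, j⟩ hm hij
    have : common base y (i, j) = 0 := by
      cases i with
      | zero => simp_all
      | succ i => rw [common, hb]; simp only [psum_smul_base, overlap_self_left]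
    simp [this]
  · simp

/-- The point `g • base` is the constant step function `g` with index `0`, so multiplying by it
neither cuts intervals nor moves indices. -/
theorem mul_smul_base_val (x : EG G) (g : G) (n : ℕ) (l : G) :
    (mul x (g • base)).1 n l = x.1 n (l * g⁻¹) := by
  classical
  change mulVal _ _ _ _ = _
  rw [mulVal, Finset.sum_eq_single (n, 0), val_eq]
  · have : common x (g • base) (n, 0) = x.weight n := by
      rw [common, psum_smul_base, psum_zero, overlap, max_eq_left (psum_le_one _ _),
        max_eq_right (psum_nonneg _ _), min_eq_right (psum_le_one _ _),
        min_eq_left (psum_mono _ n.le_succ), psum_succ, add_sub_cancel_left]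
    rw [this, label_smul_base]
    exact if_congr (by rw [mul_inv_eq_iff_eq_mul]) rfl rfl
  · rintro ⟨i, j⟩ hm hij
    have : common x (g • base) (i, j) = 0 := by
      cases j with
      | zero => simp_all
      | succ i => rw [common]; simp only [psum_smul_base, overlap_self_right]
    simp [this]
  · simp

theorem continuous_val (i : ℕ) (g : G) : Continuous fun x : EG G => x.1 i g :=
  (continuous_apply g).comp ((continuous_apply i).comp continuous_subtype_val)

/-- The topology only controls single entries, while `weight` sums over all of `G`. Since the total
is `1`, the finite support `S` of `x` still carries mass above `1 - ε / 2` at nearby points, which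
leaves less than `ε / 2` for labels outside `S`. -/
theorem continuous_weight (i : ℕ) : Continuous fun x : EG G => x.weight i := by
  classical
  rw [continuous_iff_continuousAt]
  intro x
  refine Metric.continuousAt_iff'.mpr fun ε hε => ?_
  set S := x.2.1.toFinset with hS
  have hSx : ∑ p ∈ S, x.1 p.1 p.2 = 1 := by
    refine (finsum_eq_sum_of_support_subset (fun p : ℕ × G => x.1 p.1 p.2) ?_).symm.trans x.2.2.2.1
    rw [hS, Set.Finite.coe_toFinset]
    exact Subset.rfl
  have hcont : Continuous fun y : EG G => ∑ p ∈ S, y.1 p.1 p.2 :=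
    continuous_finsetSum _ fun p _ => continuous_val _ _
  have h1 : ∀ᶠ y : EG G in 𝓝 x, 1 - ε / 2 < ∑ p ∈ S, y.1 p.1 p.2 :=
    (hcont.tendsto x).eventually_const_lt (by rw [hSx]; linarith)
  have h2 : ∀ᶠ y : EG G in 𝓝 x, dist (y.1 i (x.label i)) (x.1 i (x.label i)) < ε / 2 :=
    Metric.continuousAt_iff'.mp (continuous_val i (x.label i)).continuousAt _ (half_pos hε)
  filter_upwards [h1, h2] with y hy1 hy2
  rw [Real.dist_eq, val_label] at hy2
  have hle : y.1 i (x.label i) ≤ y.weight i := by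
    rw [val_eq]; split_ifs
    exacts [le_rfl, weight_nonneg _ _]
  have hge : y.weight i - y.1 i (x.label i) < ε / 2 := by
    by_cases hl : y.label i = x.label i
    · rw [← hl, val_label, sub_self]; exact half_pos hε
    · rw [val_eq_zero_of_ne (Ne.symm hl), sub_zero]
      have hn : (i, y.label i) ∉ S := by
        rw [hS, Set.Finite.mem_toFinset, mem_ofPred_eq, not_not]
        exact val_eq_zero_of_ne hl
      have h3 : ∑ p ∈ insert (i, y.label i) S, y.1 p.1 p.2 ≤ 1 := by
        refine le_of_le_of_eq ?_ ((finsum_eq_sum_of_support_subset (fun p : ℕ × G => y.1 p.1 p.2)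
          (s := y.2.1.toFinset ∪ insert (i, y.label i) S) ?_).symm.trans y.2.2.2.1)
        · exact Finset.sum_le_sum_of_subset_of_nonneg Finset.subset_union_right
            fun p _ _ => y.2.2.1 _ _
        · rw [Finset.coe_union, Set.Finite.coe_toFinset]
          exact subset_union_left
      rw [Finset.sum_insert hn, val_label] at h3
      linarith
  rw [Real.dist_eq, abs_lt]
  rw [abs_lt] at hy2
  constructor <;> linarith

theorem continuous_psum (i : ℕ) : Continuous fun x : EG G => x.psum i :=
  continuous_finsetSum _ fun j _ => continuous_weight j

theorem continuous_common (p : ℕ × ℕ) : Continuous fun z : EG G × EG G => common z.1 z.2 p := by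
  have h := fun i => (continuous_psum (G := G) i).comp (continuous_fst (Y := EG G))
  have h' := fun i => (continuous_psum (G := G) i).comp (continuous_snd (X := EG G))
  exact ((((h' _).max (h _)).min (h _)).sub (((h' _).max (h _)).min (h _)))

theorem eventually_label_eq {x : EG G} {i : ℕ} (h : x.weight i ≠ 0) :
    ∀ᶠ y : EG G in 𝓝 x, y.label i = x.label i := by
  rw [← val_label] at h
  exact ((continuous_val i (x.label i)).tendsto x |>.eventually_ne h).mono fun y hy => label_eq hy

/-- Where an overlap is nonzero, both labels are locally constant. Where it vanishes, labels may
jump, but the term is squeezed between `0` and the overlap. -/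
theorem continuous_mul : Continuous fun z : EG G × EG G => mul z.1 z.2 := by
  classical
  refine continuous_induced_rng.mpr (continuous_pi fun n => continuous_pi fun l => ?_)
  change Continuous fun z : EG G × EG G => mulVal z.1 z.2 n l
  refine continuous_finsetSum _ fun p _ => ?_
  rw [continuous_iff_continuousAt]
  rintro ⟨x, y⟩
  have hc := (continuous_common (G := G) p).continuousAt (x := (x, y))
  by_cases h : common x y p = 0
  · have h0 : (if l = x.label p.1 * y.label p.2 then common x y p else 0) = 0 := by simp [h]
    rw [ContinuousAt] at hc ⊢
    simp only [h0]
    simp only [h] at hc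
    refine squeeze_zero (fun z => ?_) (fun z => ?_) hc
    · split_ifs
      exacts [common_nonneg _ _ _, le_rfl]
    · split_ifs
      exacts [le_rfl, common_nonneg _ _ _]
  · have h1 := (continuous_fst (X := EG G) (Y := EG G)).tendsto (x, y) |>.eventually
      (eventually_label_eq (weight_ne_zero_left h))
    have h2 := (continuous_snd (X := EG G) (Y := EG G)).tendsto (x, y) |>.eventually
      (eventually_label_eq (weight_ne_zero_right h))
    refine ContinuousAt.congr (f := fun z : EG G × EG G =>
      if l = x.label p.1 * y.label p.2 then common z.1 z.2 p else 0) ?_ ?_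
    · split_ifs
      exacts [hc, continuousAt_const]
    · filter_upwards [h1, h2] with z hz1 hz2
      rw [hz1, hz2]

end EG

/-! ### The right multiplication of `BG` by `EG` -/

namespace BG

variable {G : Type u} [Group G]

/-- Right multiplication on `BG` by points of `EG`. -/
def act (z : BG G) (y : EG G) : BG G :=
  Quotient.liftOn z (fun x => proj (EG.mul x y)) (by
    rintro _ x ⟨g, rfl⟩
    change proj (EG.mul (g • x) y) = _
    rw [EG.smul_mul, proj_smul])

theorem act_proj (x y : EG G) : act (proj x) y = proj (EG.mul x y) := rfl

theorem continuous_proj : Continuous (proj (G := G)) := continuous_quotient_mk'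

theorem continuous_act : Continuous fun p : BG G × EG G => act p.1 p.2 := by
  -- Openness of the projection is what keeps the product with an identity a quotient map.
  have hq : IsQuotientMap (Prod.map (proj (G := G)) (id : EG G → EG G)) :=
    (isQuotientCoveringMap_proj.isOpenQuotientMap.prodMap .id).isQuotientMap
  exact hq.continuous_iff.mpr (continuous_proj.comp EG.continuous_mul)

theorem act_base (y : EG G) : act base y = proj y := by
  rw [base, act_proj, EG.base_mul]

/-- In `G \ EG` the classes of `x g⁻¹` and `g x g⁻¹` coincide. -/
theorem act_smul_base (z : BG G) (g : G) : act z (g⁻¹ • EG.base) = conj g z := by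
  obtain ⟨x, rfl⟩ := Quotient.exists_rep z
  change act (proj x) _ = conj g (proj x)
  rw [act_proj, conj_proj, ← proj_smul g]
  congr 1
  refine Subtype.ext (funext fun i => funext fun k => ?_)
  rw [EG.smul_val, EG.mul_smul_base_val, EG.conj_val, inv_inv]

theorem conj_one (z : BG G) : conj 1 z = z := by
  obtain ⟨x, rfl⟩ := Quotient.exists_rep z
  change conj 1 (proj x) = proj x
  rw [conj_proj]
  congr 1
  refine Subtype.ext (funext fun i => funext fun k => ?_)
  rw [EG.conj_val, inv_one, one_mul, mul_one]

theorem conj_conj (g h : G) (z : BG G) : conj g (conj h z) = conj (g * h) z := by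
  obtain ⟨x, rfl⟩ := Quotient.exists_rep z
  change conj g (conj h (proj x)) = conj (g * h) (proj x)
  rw [conj_proj, conj_proj, conj_proj]
  refine congrArg proj (Subtype.ext (funext fun i => funext fun k => ?_))
  rw [EG.conj_val, EG.conj_val, EG.conj_val]
  exact congrArg (x.1 i) (by group)

theorem act_base_right (z : BG G) : act z EG.base = z := by
  have h := act_smul_base z 1
  rwa [inv_one, one_smul, conj_one] at h

/-- Multiplying a closed path in `BG` by a closed path in `EG` does not change its class. -/
theorem LoopIn.act {c : Set G} {γ : I → BG G} (hγ : LoopIn c γ) {δ : I → EG G}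
    (hδ : Continuous δ) (h01 : δ 0 = δ 1) : LoopIn c fun s => act (γ s) (δ s) := by
  obtain ⟨g, hg, l, hl, hl1⟩ := hγ
  refine ⟨g, hg, ⟨fun s => EG.mul (l s) (δ s), EG.continuous_mul.comp (l.continuous.prodMk hδ)⟩,
    fun s => ?_, ?_⟩
  · change proj (EG.mul (l s) (δ s)) = BG.act (γ s) (δ s)
    rw [← hl s, act_proj]
  · change EG.mul (l 1) (δ 1) = g • EG.mul (l 0) (δ 0)
    rw [hl1, EG.smul_mul, h01]

end BG

theorem ContinuousOn.of_isClosed_cover {X Y : Type*} [TopologicalSpace X] [TopologicalSpace Y]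
    {f : X → Y} {s A B : Set X} (hA : IsClosed A) (hB : IsClosed B) (hAB : A ∪ B = univ)
    (hfA : ContinuousOn f (s ∩ A)) (hfB : ContinuousOn f (s ∩ B)) : ContinuousOn f s := by
  have key : ∀ {C : Set X}, IsClosed C → ContinuousOn f (s ∩ C) → ∀ x ∈ s,
      ContinuousWithinAt f (s ∩ C) x := by
    intro C hC hf x hx
    by_cases h : x ∈ C
    · exact hf x ⟨hx, h⟩
    · refine continuousWithinAt_of_notMem_closure fun h' => h ?_
      exact hC.closure_subset_iff.mpr inter_subset_right h'
  intro x hx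
  have h := (key hA hfA x hx).union (key hB hfB x hx)
  rwa [← inter_union_distrib_left, hAB, inter_univ] at h

/-! ### Configurations -/

namespace Conf

variable {n m : ℕ}

/-- The unordered configuration underlying an ordered one. -/
def ofFn (x : {x : Fin n → ℝ × ℝ // Function.Injective x}) : Conf n :=
  ⟨Finset.univ.map ⟨x.1, x.2⟩, by simp⟩

theorem coe_ofFn (x : {x : Fin n → ℝ × ℝ // Function.Injective x}) :
    ((ofFn x).1 : Set (ℝ × ℝ)) = range x.1 := by
  simp [ofFn]

theorem continuous_ofFn : Continuous (ofFn (n := n)) := continuous_coinduced_rng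

theorem ofFn_surjective : Function.Surjective (ofFn (n := n)) := by
  intro ξ
  let e := ξ.1.equivFinOfCardEq ξ.2
  refine ⟨⟨fun i => (e.symm i).1, Subtype.val_injective.comp e.symm.injective⟩, Subtype.ext ?_⟩
  refine Finset.coe_injective ?_
  rw [coe_ofFn]
  ext p
  exact ⟨fun ⟨i, hi⟩ => hi ▸ (e.symm i).2, fun hp => ⟨e ⟨p, hp⟩, by simp⟩⟩

/-- Two orderings of the same configuration differ by a permutation, and permuting coordinates is
continuous, so the saturation of an open set is open. -/
theorem isOpenMap_ofFn : IsOpenMap (ofFn (n := n)) := by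
  intro U hU
  refine isOpen_coinduced.mpr (isOpen_iff_mem_nhds.mpr ?_)
  rintro y ⟨x, hx, hxy⟩
  have hr : range y.1 = range x.1 := by
    rw [← coe_ofFn, ← coe_ofFn, hxy]; rfl
  let e : Fin n ≃ Fin n := (Equiv.ofInjective _ y.2).trans
    ((Equiv.setCongr hr).trans (Equiv.ofInjective _ x.2).symm)
  have he : ∀ i, x.1 (e i) = y.1 i := fun i =>
    congrArg Subtype.val ((Equiv.ofInjective _ x.2).apply_symm_apply
      (Equiv.setCongr hr (Equiv.ofInjective _ y.2 i)))
  let φ : {x : Fin n → ℝ × ℝ // Function.Injective x} →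
      {x : Fin n → ℝ × ℝ // Function.Injective x} :=
    fun z => ⟨z.1 ∘ e.symm, z.2.comp e.symm.injective⟩
  have hφ : Continuous φ := continuous_induced_rng.mpr
    (continuous_pi fun i => (continuous_apply (e.symm i)).comp continuous_subtype_val)
  have hφy : φ y = x := Subtype.ext (funext fun i => by
    change y.1 (e.symm i) = x.1 i
    rw [← he, Equiv.apply_symm_apply])
  refine mem_of_superset (hφ.continuousAt.preimage_mem_nhds (hφy.symm ▸ hU.mem_nhds hx)) ?_
  intro z hz
  refine ⟨φ z, hz, Subtype.ext (Finset.coe_injective ?_)⟩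
  rw [coe_ofFn]
  refine (e.symm.surjective.range_comp z.1).trans ?_
  exact (coe_ofFn z).symm

theorem isOpen_notMem : IsOpen {q : Conf n × (ℝ × ℝ) | q.2 ∉ q.1.1} := by
  have hq : IsQuotientMap (Prod.map (ofFn (n := n)) (id : ℝ × ℝ → ℝ × ℝ)) :=
    ((IsOpenQuotientMap.mk ofFn_surjective continuous_ofFn isOpenMap_ofFn).prodMap
      .id).isQuotientMap
  refine hq.isOpen_preimage.mp ?_
  have : Prod.map (ofFn (n := n)) (id : ℝ × ℝ → ℝ × ℝ) ⁻¹' {q | q.2 ∉ q.1.1} =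
      ⋂ i, {q | q.1.1 i ≠ q.2} := by
    ext ⟨x, p⟩
    simp [ofFn]
  rw [this]
  refine isOpen_iInter_of_finite fun i => isOpen_ne_fun ?_ continuous_snd
  exact (continuous_apply i).comp (continuous_subtype_val.comp continuous_fst)

/-- Continuity of the union of the images of two configurations under moving maps. -/
theorem continuous_of_eq_union {Z : Type*} [TopologicalSpace Z] {ξ₁ : Z → Conf n} {ξ₂ : Z → Conf m}
    (hξ₁ : Continuous ξ₁) (hξ₂ : Continuous ξ₂) {h₁ h₂ : Z → ℝ × ℝ → ℝ × ℝ}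
    (hh₁ : Continuous fun q : Z × (ℝ × ℝ) => h₁ q.1 q.2)
    (hh₂ : Continuous fun q : Z × (ℝ × ℝ) => h₂ q.1 q.2) {F : Z → Conf (n + m)}
    (hF : ∀ z, (F z).1 = (ξ₁ z).1.image (h₁ z) ∪ (ξ₂ z).1.image (h₂ z)) : Continuous F := by
  let φ : Z × (Fin n → ℝ × ℝ) × (Fin m → ℝ × ℝ) → Fin (n + m) → ℝ × ℝ :=
    fun w => Fin.append (fun i => h₁ w.1 (w.2.1 i)) (fun i => h₂ w.1 (w.2.2 i))
  have hφ : Continuous φ := by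
    refine continuous_pi fun i => ?_
    refine Fin.addCases (fun i => ?_) (fun i => ?_) i
    · simp only [φ, Fin.append_left]
      exact hh₁.comp (continuous_fst.prodMk ((continuous_apply i).comp
        (continuous_fst.comp continuous_snd)))
    · simp only [φ, Fin.append_right]
      exact hh₂.comp (continuous_fst.prodMk ((continuous_apply i).comp
        (continuous_snd.comp continuous_snd)))
  have hrange : ∀ z y₁ y₂, ofFn y₁ = ξ₁ z → ofFn y₂ = ξ₂ z →
      ((F z).1 : Set (ℝ × ℝ)) = range (φ (z, y₁.1, y₂.1)) := by
    intro z y₁ y₂ e₁ e₂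
    rw [hF, Finset.coe_union, Finset.coe_image, Finset.coe_image, ← e₁, ← e₂, coe_ofFn, coe_ofFn,
      ← range_comp, ← range_comp]
    ext p
    constructor
    · rintro (⟨i, rfl⟩ | ⟨i, rfl⟩)
      · exact ⟨Fin.castAdd m i, Fin.append_left _ _ _⟩
      · exact ⟨Fin.natAdd n i, Fin.append_right _ _ _⟩
    · rintro ⟨i, rfl⟩
      refine Fin.addCases (fun i => ?_) (fun i => ?_) i
      · exact Or.inl ⟨i, (Fin.append_left _ _ _).symm⟩
      · exact Or.inr ⟨i, (Fin.append_right _ _ _).symm⟩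
  -- Injectivity of the moving maps and disjointness of the images need not be assumed: `F z` has `n
  -- + m` points, which leaves no room for coincidences.
  have hinj : ∀ z y₁ y₂, ofFn y₁ = ξ₁ z → ofFn y₂ = ξ₂ z →
      Function.Injective (φ (z, y₁.1, y₂.1)) := by
    intro z y₁ y₂ e₁ e₂
    have h : Finset.univ.image (φ (z, y₁.1, y₂.1)) = (F z).1 :=
      Finset.coe_injective (by rw [hrange z y₁ y₂ e₁ e₂]; simp)
    have h' := Finset.card_image_iff.mp (by rw [h, (F z).2, Finset.card_univ, Fintype.card_fin])
    simpa using h'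
  have hFφ : ∀ z y₁ y₂ (e₁ : ofFn y₁ = ξ₁ z) (e₂ : ofFn y₂ = ξ₂ z),
      F z = ofFn ⟨φ (z, y₁.1, y₂.1), hinj z y₁ y₂ e₁ e₂⟩ := fun z y₁ y₂ e₁ e₂ =>
    Subtype.ext (Finset.coe_injective (by rw [coe_ofFn, hrange z y₁ y₂ e₁ e₂]))
  rw [continuous_iff_continuousAt]
  intro z₀ N hN
  rw [Filter.mem_map]
  obtain ⟨x₁, e₁⟩ := ofFn_surjective (ξ₁ z₀)
  obtain ⟨x₂, e₂⟩ := ofFn_surjective (ξ₂ z₀)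
  rw [hFφ z₀ x₁ x₂ e₁ e₂] at hN
  have hN' := continuous_ofFn.continuousAt.preimage_mem_nhds hN
  rw [nhds_subtype_eq_comap] at hN'
  obtain ⟨O, hO, hON⟩ := hN'
  have hφO := hφ.continuousAt.preimage_mem_nhds (x := (z₀, x₁.1, x₂.1)) hO
  obtain ⟨V, hV, O', hO', hVO⟩ := mem_nhds_prod_iff.mp hφO
  obtain ⟨O₁, hO₁, O₂, hO₂, hOO⟩ := mem_nhds_prod_iff.mp hO'
  -- Since `ofFn` is open, configurations near `ξ₁ z₀` have orderings near the chosen `x₁`;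
  -- continuity is then checked on ordered points.
  have k₁ : ofFn '' (Subtype.val ⁻¹' O₁) ∈ 𝓝 (ξ₁ z₀) := e₁ ▸
    isOpenMap_ofFn.image_mem_nhds (continuous_subtype_val.continuousAt.preimage_mem_nhds hO₁)
  have k₂ : ofFn '' (Subtype.val ⁻¹' O₂) ∈ 𝓝 (ξ₂ z₀) := e₂ ▸
    isOpenMap_ofFn.image_mem_nhds (continuous_subtype_val.continuousAt.preimage_mem_nhds hO₂)
  filter_upwards [hV, hξ₁.continuousAt.preimage_mem_nhds k₁,
    hξ₂.continuousAt.preimage_mem_nhds k₂]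
  rintro z hz ⟨y₁, hy₁, f₁⟩ ⟨y₂, hy₂, f₂⟩
  rw [mem_preimage, hFφ z y₁ y₂ f₁ f₂]
  exact hON (hVO (mk_mem_prod hz (hOO (mk_mem_prod hy₁ hy₂))) :)

end Conf

/-! ### Evaluation maps and the fibrewise compact-open topology -/

namespace HurN

variable {G : Type u} [Group G] {c : Set G} {n m : ℕ}

theorem continuous_toConf : Continuous (toConf (G := G) (c := c) (n := n)) :=
  continuous_iff_le_induced.mpr inf_le_left

theorem continuous_t : Continuous (HurN.t (G := G) (c := c) (n := n)) :=
  continuous_fst.comp continuous_toConf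

/-- The configuration of branch points. -/
def conf (a : HurN G c n) : Conf n := ⟨a.ξ, a.card_ξ⟩

theorem continuous_conf : Continuous (conf (G := G) (c := c) (n := n)) :=
  continuous_snd.comp continuous_toConf

theorem isClosed_mem_rect {Z : Type*} [TopologicalSpace Z] {t : Z → ℝ} {p : Z → ℝ × ℝ}
    (ht : Continuous t) (hp : Continuous p) : IsClosed {z | p z ∈ rect (t z)} := by
  have h1 : Continuous fun z => (p z).1 := continuous_fst.comp hp
  have h2 : Continuous fun z => (p z).2 := continuous_snd.comp hp
  exact ((isClosed_le continuous_const h1).inter (isClosed_le h1 ht)).inter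
    ((isClosed_le continuous_const h2).inter (isClosed_le h2 continuous_const))

/-- A map to `HurN G c n` is continuous if its first components and its evaluation are. -/
theorem continuous_of_continuousOn_eval {Z : Type*} [TopologicalSpace Z] {Φ : Z → HurN G c n}
    (ht : Continuous fun z => (Φ z).t) (hξ : Continuous fun z => (Φ z).conf)
    (hf : ContinuousOn (fun q : Z × (ℝ × ℝ) => (Φ q.1).f q.2)
      {q | q.2 ∈ rect (Φ q.1).t \ (Φ q.1).ξ}) : Continuous Φ := by
  refine continuous_inf_rng.mpr ⟨continuous_induced_rng.mpr (ht.prodMk hξ),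
    continuous_generateFrom_iff.mpr ?_⟩
  rintro _ ⟨K, U, hK, hU, rfl⟩
  refine isOpen_iff_mem_nhds.mpr ?_
  rintro z₀ ⟨hd, hm⟩
  -- By compactness of `K` it suffices to work near each `(z₀, p)`. If `p` is outside the rectangle,
  -- so are nearby points of nearby rectangles, and the condition is vacuous.
  have key : ∀ᶠ z in 𝓝 z₀, ∀ p ∈ K, p ∉ (Φ z).ξ ∧ (p ∈ rect (Φ z).t → (Φ z).f p ∈ U) := by
    refine hK.eventually_forall_of_forall_eventually fun p hp => ?_
    have hpξ : p ∉ (Φ z₀).ξ := fun h => Set.disjoint_left.mp hd hp h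
    have h1 : ∀ᶠ q : Z × (ℝ × ℝ) in 𝓝 (z₀, p), q.2 ∉ (Φ q.1).ξ :=
      (Conf.isOpen_notMem.preimage ((hξ.comp continuous_fst).prodMk continuous_snd)).mem_nhds hpξ
    refine h1.and ?_
    by_cases hpr : p ∈ rect (Φ z₀).t
    · have h2 := (hf (z₀, p) (mem_sdiff_of_mem hpr hpξ)).preimage_mem_nhdsWithin
        (hU.mem_nhds (hm (mem_inter hp hpr)))
      filter_upwards [mem_nhdsWithin_iff_eventually.mp h2, h1] with q hq hq' hqr
      exact hq ⟨hqr, hq'⟩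
    · have h2 := (isClosed_mem_rect (ht.comp continuous_fst)
        (continuous_snd (X := Z) (Y := ℝ × ℝ))).isOpen_compl.mem_nhds (x := (z₀, p)) hpr
      filter_upwards [h2] with q hq hqr
      exact absurd hqr hq
  filter_upwards [key] with z hz
  exact ⟨Set.disjoint_left.mpr fun p hp => (hz p hp).1, fun p hp => (hz p hp.1).2 hp.2⟩

/-- Local compactness of the plane supplies a compact neighbourhood `K` of `p` that misses `ξ` and
whose part in the rectangle goes into `U`; it defines a subbasic open set around `a`. -/
theorem continuousOn_eval : ContinuousOn (fun q : HurN G c n × (ℝ × ℝ) => q.1.f q.2)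
    {q | q.2 ∈ rect q.1.t \ q.1.ξ} := by
  rintro ⟨a, p⟩ ⟨hpr, hpξ⟩
  refine tendsto_nhds.mpr fun U hU hpU => ?_
  have h1 := mem_nhdsWithin_iff_eventually.mp
    ((a.f_cont p ⟨hpr, hpξ⟩).preimage_mem_nhdsWithin (hU.mem_nhds hpU))
  have h2 : ∀ᶠ q in 𝓝 p, q ∉ (a.ξ : Set (ℝ × ℝ)) :=
    a.ξ.finite_toSet.isClosed.isOpen_compl.mem_nhds hpξ
  obtain ⟨K, hK, hKs, hKc⟩ := local_compact_nhds (h1.and h2)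
  have hW : IsOpen {a : HurN G c n | Disjoint K (a.ξ : Set (ℝ × ℝ)) ∧
      MapsTo a.f (K ∩ rect a.t) U} :=
    (inf_le_right : (inferInstance : TopologicalSpace (HurN G c n)) ≤ _) _
      (TopologicalSpace.GenerateOpen.basic _ ⟨K, U, hKc, hU, rfl⟩)
  have haW : a ∈ {a : HurN G c n | Disjoint K (a.ξ : Set (ℝ × ℝ)) ∧
      MapsTo a.f (K ∩ rect a.t) U} :=
    ⟨Set.disjoint_left.mpr fun q hq => (hKs hq).2,
      fun q hq => (hKs hq.1).1 ⟨hq.2, (hKs hq.1).2⟩⟩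
  refine mem_nhdsWithin_iff_eventually.mpr ?_
  filter_upwards [prod_mem_nhds (hW.mem_nhds haW) hK] with q hq hqr
  exact hq.1.2 ⟨hq.2, hqr.1⟩

/-- The extension of `f` to the complement of the branch points in the plane, constant on vertical
lines above the upper edge of the rectangle. -/
def fext (a : HurN G c n) (p : ℝ × ℝ) : BG G := a.f (p.1, min p.2 1)

theorem fext_of_le_one (a : HurN G c n) {p : ℝ × ℝ} (hp : p.2 ≤ 1) : a.fext p = a.f p := by
  rw [fext, min_eq_left hp]

theorem fext_of_one_le (a : HurN G c n) {p : ℝ × ℝ} (hp : 1 ≤ p.2) : a.fext p = a.f (p.1, 1) := by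
  rw [fext, min_eq_right hp]

theorem fext_of_left (a : HurN G c n) {p : ℝ × ℝ} (hp : p.1 ≤ 0) : a.fext p = BG.base :=
  a.f_eq_base_of_left hp

theorem fext_of_right (a : HurN G c n) {p : ℝ × ℝ} (hp : a.t ≤ p.1) : a.fext p = BG.base :=
  a.f_eq_base_of_right hp

theorem fext_of_below (a : HurN G c n) {p : ℝ × ℝ} (hp : p.2 ≤ 0) : a.fext p = BG.base := by
  rw [fext_of_le_one _ (hp.trans zero_le_one)]
  by_cases h : p ∈ rect a.t \ a.ξ
  · exact a.f_sqcup p (Or.inr ⟨h.1.1, le_antisymm hp h.1.2.1⟩)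
  · exact a.f_off p h

theorem continuousOn_fext : ContinuousOn (fun q : HurN G c n × (ℝ × ℝ) => q.1.fext q.2)
    {q | q.2 ∉ q.1.ξ} := by
  have ht : Continuous fun q : HurN G c n × (ℝ × ℝ) => q.1.t := continuous_t.comp continuous_fst
  have hc : Continuous fun q : HurN G c n × (ℝ × ℝ) => (q.2.1, min q.2.2 1) := by fun_prop
  refine ContinuousOn.of_isClosed_cover (A := {q | (q.2.1, min q.2.2 1) ∈ rect q.1.t})
    (B := {q | q.2.1 ≤ 0 ∨ q.1.t ≤ q.2.1 ∨ q.2.2 ≤ 0}) (isClosed_mem_rect ht hc) ?_ ?_ ?_ ?_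
  · exact (isClosed_le (continuous_fst.comp continuous_snd) continuous_const).union
      ((isClosed_le ht (continuous_fst.comp continuous_snd)).union
        (isClosed_le (continuous_snd.comp continuous_snd) continuous_const))
  · refine eq_univ_of_forall fun q => ?_
    by_contra h
    simp only [rect, mem_union, mem_prod, mem_Icc, mem_ofPred_eq, not_or, not_and_or, not_le] at h
    obtain ⟨((h | h) | (h | h)), h1, h2, h3⟩ := h
    · linarith
    · linarith
    · exact absurd h (not_lt.mpr (le_min h3.le zero_le_one))
    · exact absurd h (not_lt.mpr (min_le_right _ _))
  · refine continuousOn_eval.comp (continuous_fst.prodMk hc).continuousOn ?_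
    rintro ⟨a, p⟩ ⟨h1, h2⟩
    refine ⟨h2, fun h => ?_⟩
    have h3 := (a.ξ_mem _ h).2.2
    have h4 : p.2 < 1 := by simpa using h3
    dsimp only at h
    rw [min_eq_left h4.le] at h
    exact h1 h
  · refine (continuousOn_const (c := BG.base)).congr ?_
    rintro ⟨a, p⟩ ⟨-, h | h | h⟩
    exacts [a.fext_of_left h, a.fext_of_right h, a.fext_of_below h]

/-! ### The lift of the upper edge -/

variable (G c n) in
/-- The restriction of `f` to the upper edge, as a family of loops. -/
def edge : C(I × HurN G c n, BG G) where
  toFun q := q.2.topLoop q.1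
  continuous_toFun := by
    have h : (fun q : I × HurN G c n => q.2.topLoop q.1) =
        fun q => q.2.fext ((q.1 : ℝ) * q.2.t, 1) :=
      funext fun q => (q.2.fext_of_one_le (p := ((q.1 : ℝ) * q.2.t, 1)) le_rfl).symm
    rw [h]
    have ht : Continuous fun q : I × HurN G c n => q.2.t := continuous_t.comp continuous_snd
    exact continuousOn_fext.comp_continuous
      (f := fun q : I × HurN G c n => (q.2, ((q.1 : ℝ) * q.2.t, (1 : ℝ))))
      (continuous_snd.prodMk (((continuous_subtype_val.comp continuous_fst).mul ht).prodMk
        continuous_const)) fun q h => lt_irrefl _ (q.2.ξ_mem _ h).2.2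

variable (G c n) in
/-- The lifts to `EG` of the upper edges, starting at the base vertex. -/
def edgeLift : C(I × HurN G c n, EG G) :=
  BG.isQuotientCoveringMap_proj.isCoveringMap.liftHomotopy (edge G c n) (.const _ EG.base)
    fun a => a.topLoop.source

theorem proj_edgeLift (a : HurN G c n) (s : I) :
    BG.proj (edgeLift G c n (s, a)) = a.f (s * a.t, 1) :=
  congrFun (BG.isQuotientCoveringMap_proj.isCoveringMap.liftHomotopy_lifts (edge G c n)
    (.const _ EG.base) fun a => a.topLoop.source) (s, a)

theorem edgeLift_zero (a : HurN G c n) : edgeLift G c n (0, a) = EG.base :=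
  BG.isQuotientCoveringMap_proj.isCoveringMap.liftHomotopy_zero (edge G c n)
    (.const _ EG.base) (fun a => a.topLoop.source) a

theorem edgeLift_one (a : HurN G c n) : edgeLift G c n (1, a) = a.μ • EG.base := by
  obtain ⟨l, hl, h0, h1⟩ := (BG.existsUnique_loopClass a.topLoop).choose_spec.1
  have cov := (BG.isQuotientCoveringMap_proj (G := G)).isCoveringMap
  have e1 := (cov.eq_liftPath_iff' (γ := (a.topLoop : C(I, BG G))) (e := EG.base)
    a.topLoop.source).mpr ⟨funext hl, h0⟩
  have e2 := (cov.eq_liftPath_iff' (γ := (a.topLoop : C(I, BG G))) (e := EG.base)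
    a.topLoop.source (Γ := ⟨fun s => edgeLift G c n (s, a), by fun_prop⟩)).mpr
      ⟨funext (proj_edgeLift a), edgeLift_zero a⟩
  have e3 := DFunLike.congr_fun (e2.trans e1.symm) 1
  exact e3.trans h1

/-- The endpoint of the lifted edge moves continuously within the discrete orbit of the base vertex;
its entry at `(0, a.μ)` stays nonzero and identifies the translate. -/
theorem eventually_μ_eq (a : HurN G c n) : ∀ᶠ b in 𝓝 a, b.μ = a.μ := by
  have h : Continuous fun b : HurN G c n => (edgeLift G c n (1, b)).1 0 a.μ :=
    (EG.continuous_val 0 a.μ).comp (by fun_prop)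
  have ha : (edgeLift G c n (1, a)).1 0 a.μ ≠ 0 := by
    rw [edgeLift_one, EG.val_smul_base]; exact one_ne_zero
  filter_upwards [h.continuousAt.eventually_ne ha] with b hb
  rw [edgeLift_one] at hb
  rw [← EG.label_eq hb, EG.label_smul_base]

/-- The lift to `EG` of the restriction of `f` to the upper edge, ending at the base vertex and
constant outside of `[0, t]`. -/
def roof (a : HurN G c n) (x : ℝ) : EG G :=
  a.μ⁻¹ • edgeLift G c n (projIcc 0 1 zero_le_one (x / a.t), a)

theorem continuous_roof : Continuous fun q : HurN G c n × ℝ => q.1.roof q.2 := by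
  have hc : Continuous fun q : HurN G c n × ℝ =>
      edgeLift G c n (projIcc 0 1 zero_le_one (q.2 / q.1.t), q.1) :=
    (edgeLift G c n).continuous.comp ((continuous_projIcc.comp (continuous_snd.div
      (continuous_t.comp continuous_fst) fun q => q.1.t_pos.ne')).prodMk continuous_fst)
  rw [continuous_iff_continuousAt]
  rintro ⟨a, x⟩
  refine (((EG.continuous_relabel (Equiv.mulLeft a.μ⁻¹⁻¹)).comp hc).continuousAt).congr ?_
  filter_upwards [continuous_fst.continuousAt.eventually (eventually_μ_eq a)] with q hq
  rw [roof, hq]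
  rfl

theorem roof_of_left (a : HurN G c n) {x : ℝ} (hx : x ≤ 0) : a.roof x = a.μ⁻¹ • EG.base := by
  rw [roof, projIcc_of_le_left _ (div_nonpos_of_nonpos_of_nonneg hx a.t_pos.le)]
  exact congrArg _ (edgeLift_zero a)

theorem roof_of_right (a : HurN G c n) {x : ℝ} (hx : a.t ≤ x) : a.roof x = EG.base := by
  rw [roof, projIcc_of_right_le _ ((one_le_div a.t_pos).mpr hx)]
  exact (congrArg _ (edgeLift_one a)).trans (inv_smul_smul _ _)

theorem proj_roof (a : HurN G c n) {p : ℝ × ℝ} (hp : 1 ≤ p.2) :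
    BG.proj (a.roof p.1) = a.fext p := by
  rcases le_total p.1 0 with h | h
  · rw [roof_of_left _ h, BG.proj_smul, fext_of_left _ h]; rfl
  rcases le_total a.t p.1 with h' | h'
  · rw [roof_of_right _ h', fext_of_right _ h']; rfl
  · rw [roof, BG.proj_smul, proj_edgeLift, fext_of_one_le _ hp,
      projIcc_of_mem _ ⟨div_nonneg h a.t_pos.le, (div_le_one a.t_pos).mpr h'⟩,
      div_mul_cancel₀ _ a.t_pos.ne']

theorem loopIn_fext (a : HurN G c n) {p : ℝ × ℝ} (hp : p ∈ a.ξ) :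
    ∀ᶠ r in 𝓝[>] (0 : ℝ), BG.LoopIn c fun s => a.fext (smallLoop p r s) := by
  have h1 := (a.ξ_mem p hp).2.2
  filter_upwards [a.f_loop p hp, Ioo_mem_nhdsGT (sub_pos.mpr h1)] with r hr hr'
  convert! hr using 2 with s
  refine a.fext_of_le_one ?_
  have := (mul_le_of_le_one_right hr'.1.le (Real.neg_one_le_sin (2 * Real.pi * s) |> neg_le.mp))
  simp only [smallLoop]
  linarith [hr'.2]

end HurN

/-! ### Small loops -/

theorem continuous_smallLoop (p : ℝ × ℝ) : Continuous fun q : ℝ × I => smallLoop p q.1 q.2 := by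
  unfold smallLoop
  fun_prop

/-- At radius `0` the loop is constant at `p`; compactness of `I` makes the radius uniform in `s`.
-/
theorem eventually_smallLoop {p : ℝ × ℝ} {P : ℝ × ℝ → Prop} (h : ∀ᶠ q in 𝓝 p, P q) :
    ∀ᶠ r in 𝓝[>] (0 : ℝ), ∀ s : I, P (smallLoop p r s) := by
  have h0 : ∀ s : I, smallLoop p 0 s = p := fun s => by simp [smallLoop]
  have key : ∀ᶠ r in 𝓝 (0 : ℝ), ∀ s ∈ (univ : Set I), P (smallLoop p r s) := by
    refine isCompact_univ.eventually_forall_of_forall_eventually fun s _ => ?_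
    exact (continuous_smallLoop p).continuousAt.eventually
      (show ∀ᶠ q in 𝓝 (smallLoop p 0 s), P q from (h0 s).symm ▸ h)
  exact (key.filter_mono nhdsWithin_le_nhds).mono fun r hr s => hr s (mem_univ s)

theorem smallLoop_ne (p : ℝ × ℝ) {r : ℝ} (hr : 0 < r) (s : I) : smallLoop p r s ≠ p := by
  intro h
  have h1 : r * Real.cos (2 * Real.pi * s) = 0 := by
    have := congrArg Prod.fst h
    simp only [smallLoop] at this; linarith
  have h2 : r * Real.sin (2 * Real.pi * s) = 0 := by
    have := congrArg Prod.snd h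
    simp only [smallLoop] at this; linarith
  have h3 := Real.sin_sq_add_cos_sq (2 * Real.pi * s)
  rw [(mul_eq_zero_iff_left hr.ne').mp h1, (mul_eq_zero_iff_left hr.ne').mp h2] at h3
  norm_num at h3

theorem smallLoop_zero_eq_one (p : ℝ × ℝ) (r : ℝ) : smallLoop p r 0 = smallLoop p r 1 := by
  simp [smallLoop]

/-! ### Sliding one rectangle over another -/

/-- The parameters of the slide: a scaling factor at least `1` and a time in `[0, 1]`; horizontal
motion only takes place at half scale. -/
def SlideParam : Type :=
  {q : ℝ × ℝ // 1 ≤ q.1 ∧ (0 ≤ q.2 ∧ q.2 ≤ 1) ∧ (q.1 = 2 ∨ q.2 = 0 ∨ q.2 = 1)}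

namespace SlideParam

instance : TopologicalSpace SlideParam := instTopologicalSpaceSubtype

/-- The scaling factor. -/
def scale (π : SlideParam) : ℝ := π.1.1

/-- The time. -/
def s (π : SlideParam) : ℝ := π.1.2

theorem continuous_scale : Continuous scale := continuous_fst.comp continuous_subtype_val

theorem continuous_s : Continuous s := continuous_snd.comp continuous_subtype_val

theorem one_le_scale (π : SlideParam) : 1 ≤ π.scale := π.2.1

theorem scale_pos (π : SlideParam) : 0 < π.scale := zero_lt_one.trans_le π.one_le_scale

theorem s_nonneg (π : SlideParam) : 0 ≤ π.s := π.2.2.1.1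

theorem s_le_one (π : SlideParam) : π.s ≤ 1 := π.2.2.1.2

theorem cases (π : SlideParam) : π.scale = 2 ∨ π.s = 0 ∨ π.s = 1 := π.2.2.2

/-- The path of parameters that shrinks the rectangles, exchanges them, and enlarges them. -/
def path : C(I, SlideParam) where
  -- The scale goes from `1` to `2` on the first third, rests at `2` on the second while the time
  -- runs from `0` to `1`, and returns to `1` on the last.
  toFun τ := ⟨(min 2 (min (1 + 3 * (τ : ℝ)) (4 - 3 * τ)), max 0 (min 1 (3 * τ - 1))), by
    obtain ⟨τ, h0, h1⟩ := τ
    refine ⟨le_min one_le_two (le_min (by linarith) (by linarith)),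
      ⟨le_max_left _ _, max_le zero_le_one (min_le_left _ _)⟩, ?_⟩
    rcases le_total τ (1 / 3) with h | h
    · exact Or.inr (Or.inl (max_eq_left ((min_le_right _ _).trans (by linarith))))
    rcases le_total τ (2 / 3) with h' | h'
    · exact Or.inl (min_eq_left (le_min (by linarith) (by linarith)))
    · refine Or.inr (Or.inr ?_)
      dsimp only
      rw [min_eq_left (by linarith), max_eq_right zero_le_one]⟩
  continuous_toFun := continuous_induced_rng.mpr (by
    change Continuous fun τ : I =>
      (min 2 (min (1 + 3 * (τ : ℝ)) (4 - 3 * τ)), max 0 (min 1 (3 * (τ : ℝ) - 1)))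
    fun_prop)

theorem scale_path_zero : (path 0).scale = 1 := by
  change min 2 (min (1 + 3 * ((0 : I) : ℝ)) (4 - 3 * ((0 : I) : ℝ))) = 1
  norm_num

theorem s_path_zero : (path 0).s = 0 := by
  change max 0 (min 1 (3 * ((0 : I) : ℝ) - 1)) = 0
  norm_num

theorem scale_path_one : (path 1).scale = 1 := by
  change min 2 (min (1 + 3 * ((1 : I) : ℝ)) (4 - 3 * ((1 : I) : ℝ))) = 1
  norm_num

theorem s_path_one : (path 1).s = 1 := by
  change max 0 (min 1 (3 * ((1 : I) : ℝ) - 1)) = 1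
  norm_num

end SlideParam

namespace HurN

variable {G : Type u} [Group G] {c : Set G} {n m : ℕ} (a : HurN G c n) (b : HurN G c m)
  (π : SlideParam)

/-- The coordinates of the plane with respect to the rectangle of `a`. -/
def toLower (p : ℝ × ℝ) : ℝ × ℝ := (π.scale * p.1 - π.s * b.t, π.scale * p.2)

/-- The coordinates of the plane with respect to the rectangle of `b`. -/
def toUpper (p : ℝ × ℝ) : ℝ × ℝ := (π.scale * p.1 - (1 - π.s) * a.t, π.scale * (p.2 - 1) + 1)

/-- The inverse of `toLower`. -/
def ofLower (q : ℝ × ℝ) : ℝ × ℝ := ((q.1 + π.s * b.t) / π.scale, q.2 / π.scale)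

/-- The inverse of `toUpper`. -/
def ofUpper (q : ℝ × ℝ) : ℝ × ℝ := ((q.1 + (1 - π.s) * a.t) / π.scale, (q.2 - 1) / π.scale + 1)

theorem toLower_ofLower (q : ℝ × ℝ) : b.toLower π (b.ofLower π q) = q := by
  have := π.scale_pos.ne'
  ext
  · simp only [toLower, ofLower]; field_simp; ring
  · simp only [toLower, ofLower]; field_simp

theorem ofLower_toLower (p : ℝ × ℝ) : b.ofLower π (b.toLower π p) = p := by
  have := π.scale_pos.ne'
  ext
  · simp only [toLower, ofLower]; field_simp; ring
  · simp only [toLower, ofLower]; field_simp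

theorem toUpper_ofUpper (q : ℝ × ℝ) : a.toUpper π (a.ofUpper π q) = q := by
  have := π.scale_pos.ne'
  ext <;> simp only [toUpper, ofUpper] <;> field_simp <;> ring

theorem ofUpper_toUpper (p : ℝ × ℝ) : a.ofUpper π (a.toUpper π p) = p := by
  have := π.scale_pos.ne'
  ext <;> simp only [toUpper, ofUpper] <;> field_simp <;> ring

theorem toLower_smallLoop (p : ℝ × ℝ) (r : ℝ) (s : I) :
    b.toLower π (smallLoop p r s) = smallLoop (b.toLower π p) (π.scale * r) s := by
  ext <;> simp only [toLower, smallLoop] <;> ring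

theorem toUpper_smallLoop (p : ℝ × ℝ) (r : ℝ) (s : I) :
    a.toUpper π (smallLoop p r s) = smallLoop (a.toUpper π p) (π.scale * r) s := by
  ext <;> simp only [toUpper, smallLoop] <;> ring

theorem continuous_toLower :
    Continuous fun q : (HurN G c m × SlideParam) × (ℝ × ℝ) => q.1.1.toLower q.1.2 q.2 := by
  have h1 := (continuous_t (G := G) (c := c) (n := m)).comp
    (continuous_fst.comp (continuous_fst (X := HurN G c m × SlideParam) (Y := ℝ × ℝ)))
  have h2 := SlideParam.continuous_scale.comp
    (continuous_snd.comp (continuous_fst (X := HurN G c m × SlideParam) (Y := ℝ × ℝ)))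
  have h3 := SlideParam.continuous_s.comp
    (continuous_snd.comp (continuous_fst (X := HurN G c m × SlideParam) (Y := ℝ × ℝ)))
  simp only [Function.comp_def] at h1 h2 h3
  unfold toLower
  fun_prop

theorem continuous_toUpper :
    Continuous fun q : (HurN G c n × SlideParam) × (ℝ × ℝ) => q.1.1.toUpper q.1.2 q.2 := by
  have h1 := (continuous_t (G := G) (c := c) (n := n)).comp
    (continuous_fst.comp (continuous_fst (X := HurN G c n × SlideParam) (Y := ℝ × ℝ)))
  have h2 := SlideParam.continuous_scale.comp
    (continuous_snd.comp (continuous_fst (X := HurN G c n × SlideParam) (Y := ℝ × ℝ)))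
  have h3 := SlideParam.continuous_s.comp
    (continuous_snd.comp (continuous_fst (X := HurN G c n × SlideParam) (Y := ℝ × ℝ)))
  simp only [Function.comp_def] at h1 h2 h3
  unfold toUpper
  fun_prop

theorem continuous_ofLower :
    Continuous fun q : (HurN G c m × SlideParam) × (ℝ × ℝ) => q.1.1.ofLower q.1.2 q.2 := by
  have h1 := (continuous_t (G := G) (c := c) (n := m)).comp
    (continuous_fst.comp (continuous_fst (X := HurN G c m × SlideParam) (Y := ℝ × ℝ)))
  have h2 := SlideParam.continuous_scale.comp
    (continuous_snd.comp (continuous_fst (X := HurN G c m × SlideParam) (Y := ℝ × ℝ)))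
  have h3 := SlideParam.continuous_s.comp
    (continuous_snd.comp (continuous_fst (X := HurN G c m × SlideParam) (Y := ℝ × ℝ)))
  have h0 : ∀ q : (HurN G c m × SlideParam) × (ℝ × ℝ), q.1.2.scale ≠ 0 :=
    fun q => q.1.2.scale_pos.ne'
  simp only [Function.comp_def] at h1 h2 h3
  exact ((continuous_fst.comp continuous_snd).add (h3.mul h1) |>.div h2 h0).prodMk
    ((continuous_snd.comp continuous_snd).div h2 h0)

theorem continuous_ofUpper :
    Continuous fun q : (HurN G c n × SlideParam) × (ℝ × ℝ) => q.1.1.ofUpper q.1.2 q.2 := by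
  have h1 := (continuous_t (G := G) (c := c) (n := n)).comp
    (continuous_fst.comp (continuous_fst (X := HurN G c n × SlideParam) (Y := ℝ × ℝ)))
  have h2 := SlideParam.continuous_scale.comp
    (continuous_snd.comp (continuous_fst (X := HurN G c n × SlideParam) (Y := ℝ × ℝ)))
  have h3 := SlideParam.continuous_s.comp
    (continuous_snd.comp (continuous_fst (X := HurN G c n × SlideParam) (Y := ℝ × ℝ)))
  have h0 : ∀ q : (HurN G c n × SlideParam) × (ℝ × ℝ), q.1.2.scale ≠ 0 :=
    fun q => q.1.2.scale_pos.ne'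
  simp only [Function.comp_def] at h1 h2 h3
  exact ((continuous_fst.comp continuous_snd).add ((continuous_const.sub h3).mul h1)
    |>.div h2 h0).prodMk ((((continuous_snd.comp continuous_snd).sub continuous_const).div h2
      h0).add continuous_const)

/-- The points lying on or above the rectangle of `b`. -/
def upperRegion : Set (ℝ × ℝ) :=
  {p | (0 ≤ (a.toUpper π p).1 ∧ (a.toUpper π p).1 ≤ b.t) ∧ 0 ≤ (a.toUpper π p).2}

/-- The restriction on slide parameters enters here: at scale `2` the two rectangles are separated
by the line of height `1/2`, at times `0` and `1` by a vertical line. -/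
theorem notMem_upperRegion {p : ℝ × ℝ} (h0 : 0 < (b.toLower π p).1) (h1 : (b.toLower π p).1 < a.t)
    (h2 : (b.toLower π p).2 < 1) : p ∉ upperRegion a b π := by
  rintro ⟨⟨k0, k1⟩, k2⟩
  simp only [toLower, toUpper] at *
  rcases π.cases with h | h | h
  · rw [h] at h2 k2; linarith
  · rw [h] at h1 k0; linarith
  · rw [h] at h0 k1; linarith

/-- At scale `2` the region lies above the upper edge of `a`, where `roof` lifts the extended map.
At times `0` and `1` it lies to the right or left of `a`, where both sides are the basepoint. -/
theorem fext_toLower {p : ℝ × ℝ} (hp : p ∈ upperRegion a b π) :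
    a.fext (b.toLower π p) = BG.act BG.base (a.roof (b.toLower π p).1) := by
  rw [BG.act_base]
  obtain ⟨⟨k0, k1⟩, k2⟩ := hp
  simp only [toUpper] at k0 k1 k2
  rcases π.cases with h | h | h
  · refine (a.proj_roof ?_).symm
    simp only [toLower]
    rw [h] at k2 ⊢
    linarith
  · have h' : a.t ≤ (b.toLower π p).1 := by
      simp only [toLower]
      rw [h] at k0 ⊢
      linarith
    rw [fext_of_right _ h', roof_of_right _ h']
    rfl
  · have h' : (b.toLower π p).1 ≤ 0 := by
      simp only [toLower]
      rw [h] at k1 ⊢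
      linarith
    rw [fext_of_left _ h', roof_of_left _ h', BG.proj_smul]
    rfl

open Classical in
/-- The map given by `a` and `b`, placed in their rectangles; above the rectangle of `a`, the map
given by `b` is dragged along the lift of the upper edge of `a`. -/
def slideMap (p : ℝ × ℝ) : BG G :=
  if p ∈ upperRegion a b π then BG.act (b.fext (a.toUpper π p)) (a.roof (b.toLower π p).1)
  else a.fext (b.toLower π p)

theorem slideMap_of_mem {p : ℝ × ℝ} (hp : p ∈ upperRegion a b π) :
    slideMap a b π p = BG.act (b.fext (a.toUpper π p)) (a.roof (b.toLower π p).1) := if_pos hp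

theorem slideMap_of_notMem {p : ℝ × ℝ} (hp : p ∉ upperRegion a b π) :
    slideMap a b π p = a.fext (b.toLower π p) := if_neg hp

/-- On the left, right and lower boundary of the upper region `b` is at the basepoint, so both
formulas for the slide agree; this is the gluing used in `continuousOn_slideMap`. -/
theorem slideMap_of_or {p : ℝ × ℝ} (hp : (a.toUpper π p).1 ≤ 0 ∨ b.t ≤ (a.toUpper π p).1 ∨
    (a.toUpper π p).2 ≤ 0) : slideMap a b π p = a.fext (b.toLower π p) := by
  by_cases h : p ∈ upperRegion a b π
  · have hb : b.fext (a.toUpper π p) = BG.base := by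
      rcases hp with hp | hp | hp
      exacts [b.fext_of_left hp, b.fext_of_right hp, b.fext_of_below hp]
    rw [slideMap_of_mem _ _ _ h, hb, fext_toLower _ _ _ h]
  · exact slideMap_of_notMem _ _ _ h

/-- The branch points of `a` and `b`, placed in their rectangles. -/
def slideξ : Finset (ℝ × ℝ) := a.ξ.image (b.ofLower π) ∪ b.ξ.image (a.ofUpper π)

variable {a b π} in
theorem toLower_notMem {p : ℝ × ℝ} (hp : p ∉ slideξ a b π) : b.toLower π p ∉ a.ξ := fun h =>
  hp (Finset.mem_union_left _ (Finset.mem_image.mpr ⟨_, h, ofLower_toLower b π p⟩))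

variable {a b π} in
theorem toUpper_notMem {p : ℝ × ℝ} (hp : p ∉ slideξ a b π) : a.toUpper π p ∉ b.ξ := fun h =>
  hp (Finset.mem_union_right _ (Finset.mem_image.mpr ⟨_, h, ofUpper_toUpper a π p⟩))

theorem isClosed_upperRegion : IsClosed {q : (HurN G c n × HurN G c m × SlideParam) × (ℝ × ℝ) |
    q.2 ∈ upperRegion q.1.1 q.1.2.1 q.1.2.2} := by
  have hU : Continuous fun q : (HurN G c n × HurN G c m × SlideParam) × (ℝ × ℝ) =>
      q.1.1.toUpper q.1.2.2 q.2 :=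
    continuous_toUpper.comp (f := fun q : (HurN G c n × HurN G c m × SlideParam) × (ℝ × ℝ) =>
      ((q.1.1, q.1.2.2), q.2)) (by fun_prop)
  have ht : Continuous fun q : (HurN G c n × HurN G c m × SlideParam) × (ℝ × ℝ) => q.1.2.1.t :=
    continuous_t.comp (by fun_prop)
  have hU1 := continuous_fst.comp hU
  exact ((isClosed_le continuous_const hU1).inter (isClosed_le hU1 ht)).inter
    (isClosed_le continuous_const (continuous_snd.comp hU))

theorem continuousOn_slideMap :
    ContinuousOn (fun q : (HurN G c n × HurN G c m × SlideParam) × (ℝ × ℝ) =>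
      slideMap q.1.1 q.1.2.1 q.1.2.2 q.2) {q | q.2 ∉ slideξ q.1.1 q.1.2.1 q.1.2.2} := by
  have hU : Continuous fun q : (HurN G c n × HurN G c m × SlideParam) × (ℝ × ℝ) =>
      q.1.1.toUpper q.1.2.2 q.2 :=
    continuous_toUpper.comp (f := fun q : (HurN G c n × HurN G c m × SlideParam) × (ℝ × ℝ) =>
      ((q.1.1, q.1.2.2), q.2)) (by fun_prop)
  have hL : Continuous fun q : (HurN G c n × HurN G c m × SlideParam) × (ℝ × ℝ) =>
      q.1.2.1.toLower q.1.2.2 q.2 :=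
    continuous_toLower.comp (f := fun q : (HurN G c n × HurN G c m × SlideParam) × (ℝ × ℝ) =>
      ((q.1.2.1, q.1.2.2), q.2)) (by fun_prop)
  have ht : Continuous fun q : (HurN G c n × HurN G c m × SlideParam) × (ℝ × ℝ) => q.1.2.1.t :=
    continuous_t.comp (by fun_prop)
  have hU1 := continuous_fst.comp hU
  refine ContinuousOn.of_isClosed_cover (A := {q | q.2 ∈ upperRegion q.1.1 q.1.2.1 q.1.2.2})
    (B := {q | (q.1.1.toUpper q.1.2.2 q.2).1 ≤ 0 ∨ q.1.2.1.t ≤ (q.1.1.toUpper q.1.2.2 q.2).1 ∨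
      (q.1.1.toUpper q.1.2.2 q.2).2 ≤ 0}) isClosed_upperRegion ?_ ?_ ?_ ?_
  · exact (isClosed_le hU1 continuous_const).union
      ((isClosed_le ht hU1).union (isClosed_le (continuous_snd.comp hU) continuous_const))
  · refine eq_univ_of_forall fun q => ?_
    by_contra h
    simp only [mem_union, mem_ofPred_eq, not_or, not_le, upperRegion] at h
    exact h.1 ⟨⟨h.2.1.le, h.2.2.1.le⟩, h.2.2.2.le⟩
  · have h1 : ContinuousOn (fun q : (HurN G c n × HurN G c m × SlideParam) × (ℝ × ℝ) =>
        q.1.2.1.fext (q.1.1.toUpper q.1.2.2 q.2)) {q | q.2 ∉ slideξ q.1.1 q.1.2.1 q.1.2.2} :=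
      continuousOn_fext.comp (f := fun q : (HurN G c n × HurN G c m × SlideParam) × (ℝ × ℝ) =>
        (q.1.2.1, q.1.1.toUpper q.1.2.2 q.2))
        (Continuous.continuousOn (by fun_prop)) fun q hq => toUpper_notMem hq
    have h2 : Continuous fun q : (HurN G c n × HurN G c m × SlideParam) × (ℝ × ℝ) =>
        q.1.1.roof (q.1.2.1.toLower q.1.2.2 q.2).1 :=
      continuous_roof.comp (f := fun q : (HurN G c n × HurN G c m × SlideParam) × (ℝ × ℝ) =>
        (q.1.1, (q.1.2.1.toLower q.1.2.2 q.2).1))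
        ((continuous_fst.comp continuous_fst).prodMk (continuous_fst.comp hL))
    refine (BG.continuous_act.comp_continuousOn ((h1.mono inter_subset_left).prodMk
      h2.continuousOn)).congr fun q hq => slideMap_of_mem _ _ _ hq.2
  · refine (continuousOn_fext.comp
      (f := fun q : (HurN G c n × HurN G c m × SlideParam) × (ℝ × ℝ) =>
        (q.1.1, q.1.2.1.toLower q.1.2.2 q.2)) (Continuous.continuousOn (by fun_prop))
      fun q hq => toLower_notMem hq.1).congr fun q hq => slideMap_of_or _ _ _ hq.2

variable {a b π} in
theorem ofLower_notMem_upperRegion {q : ℝ × ℝ} (hq : q ∈ a.ξ) :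
    b.ofLower π q ∉ upperRegion a b π := by
  obtain ⟨h1, h2⟩ := a.ξ_mem q hq
  refine notMem_upperRegion _ _ _ ?_ ?_ ?_ <;> rw [toLower_ofLower]
  exacts [h1.1, h1.2, h2.2]

variable {a b π} in
theorem ofUpper_mem_upperRegion {q : ℝ × ℝ} (hq : q ∈ b.ξ) :
    a.ofUpper π q ∈ upperRegion a b π := by
  obtain ⟨h1, h2⟩ := b.ξ_mem q hq
  rw [upperRegion, mem_ofPred_eq, toUpper_ofUpper]
  exact ⟨⟨h1.1.le, h1.2.le⟩, h2.1.le⟩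

theorem slideξ_card : (slideξ a b π).card = n + m := by
  rw [slideξ, Finset.card_union_of_disjoint,
    Finset.card_image_of_injective _ (Function.LeftInverse.injective (toLower_ofLower b π)),
    Finset.card_image_of_injective _ (Function.LeftInverse.injective (toUpper_ofUpper a π)),
    a.card_ξ, b.card_ξ]
  rw [Finset.disjoint_left]
  intro p hp hp'
  obtain ⟨q, hq, rfl⟩ := Finset.mem_image.mp hp
  obtain ⟨q', hq', h⟩ := Finset.mem_image.mp hp'
  exact ofLower_notMem_upperRegion hq (h ▸ ofUpper_mem_upperRegion hq')

theorem slideξ_mem (p : ℝ × ℝ) (hp : p ∈ slideξ a b π) :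
    p ∈ Ioo 0 ((a.t + b.t) / π.scale) ×ˢ Ioo (0 : ℝ) 1 := by
  have h1 := π.one_le_scale
  have hpos := π.scale_pos
  have ha := a.t_pos
  have hb := b.t_pos
  have h2 := mul_nonneg π.s_nonneg hb.le
  have h3 := mul_nonneg (sub_nonneg.mpr π.s_le_one) hb.le
  have h4 := mul_nonneg π.s_nonneg ha.le
  have h5 := mul_nonneg (sub_nonneg.mpr π.s_le_one) ha.le
  rcases Finset.mem_union.mp hp with hp | hp
  · obtain ⟨q, hq, rfl⟩ := Finset.mem_image.mp hp
    obtain ⟨k1, k2⟩ := a.ξ_mem q hq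
    refine ⟨⟨div_pos (by linarith [k1.1]) hpos, div_lt_div_of_pos_right (by linarith [k1.2]) hpos⟩,
      div_pos k2.1 hpos, (div_lt_one hpos).mpr (k2.2.trans_le h1)⟩
  · obtain ⟨q, hq, rfl⟩ := Finset.mem_image.mp hp
    obtain ⟨k1, k2⟩ := b.ξ_mem q hq
    refine ⟨⟨div_pos (by linarith [k1.1]) hpos, div_lt_div_of_pos_right (by linarith [k1.2]) hpos⟩,
      ?_, ?_⟩
    · have : (-1 : ℝ) < (q.2 - 1) / π.scale := by
        rw [lt_div_iff₀ hpos]; linarith [k2.1]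
      simp only [ofUpper]; linarith
    · have : (q.2 - 1) / π.scale < 0 := div_neg_of_neg_of_pos (by linarith [k2.2]) hpos
      simp only [ofUpper]; linarith

theorem slideMap_sqcup {p : ℝ × ℝ} (hp : p ∈ sqcup ((a.t + b.t) / π.scale)) :
    slideMap a b π p = BG.base := by
  have h1 := π.one_le_scale
  have hpos := π.scale_pos
  have ha := a.t_pos
  have hb := b.t_pos
  have h2 := mul_nonneg π.s_nonneg hb.le
  have h3 := mul_nonneg (sub_nonneg.mpr π.s_le_one) hb.le
  have h4 := mul_nonneg π.s_nonneg ha.le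
  have h5 := mul_nonneg (sub_nonneg.mpr π.s_le_one) ha.le
  rcases hp with ⟨hp | hp, -⟩ | ⟨-, hp⟩
  · rw [slideMap_of_or, fext_of_left]
    · simp only [toLower, hp]; linarith
    · left; simp only [toUpper, hp]; linarith
  · have hp : π.scale * p.1 = a.t + b.t := by
      rw [show p.1 = _ from hp, mul_div_cancel₀ _ hpos.ne']
    rw [slideMap_of_or, fext_of_right]
    · simp only [toLower, hp]; linarith
    · right; left; simp only [toUpper, hp]; linarith
  · rw [slideMap_of_or, fext_of_below]
    · simp only [toLower, show p.2 = 0 from hp, mul_zero, le_refl]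
    · right; right; simp only [toUpper, show p.2 = 0 from hp]; linarith

/-- Near a branch point of `a` the slide is a rescaled copy of `a`. Near one of `b` it is a rescaled
copy of `b` times `roof` along the small circle, a closed path in `EG`, so `BG.LoopIn.act` applies.
-/
theorem loopIn_slideMap (p : ℝ × ℝ) (hp : p ∈ slideξ a b π) :
    ∀ᶠ r in 𝓝[>] (0 : ℝ), BG.LoopIn c fun s => slideMap a b π (smallLoop p r s) := by
  have hU : Continuous (a.toUpper π) :=
    continuous_toUpper.comp (f := fun q : ℝ × ℝ => ((a, π), q)) (by fun_prop)
  have hL : Continuous (b.toLower π) :=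
    continuous_toLower.comp (f := fun q : ℝ × ℝ => ((b, π), q)) (by fun_prop)
  have hscale : Tendsto (fun r : ℝ => π.scale * r) (𝓝[>] 0) (𝓝[>] 0) := by
    refine tendsto_nhdsWithin_iff.mpr ⟨?_, ?_⟩
    · have : Tendsto (fun r : ℝ => π.scale * r) (𝓝 0) (𝓝 (π.scale * 0)) := by
        exact (continuous_const.mul continuous_id).tendsto 0
      rw [mul_zero] at this
      exact this.mono_left nhdsWithin_le_nhds
    · filter_upwards [self_mem_nhdsWithin] with r hr
      exact mul_pos π.scale_pos hr
  have hcl : IsClosed (upperRegion a b π) :=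
    isClosed_upperRegion.preimage (f := fun p : ℝ × ℝ => ((a, b, π), p)) (by fun_prop)
  rcases Finset.mem_union.mp hp with hp | hp
  · obtain ⟨q, hq, rfl⟩ := Finset.mem_image.mp hp
    filter_upwards [hscale.eventually (a.loopIn_fext hq), eventually_smallLoop
      (hcl.isOpen_compl.mem_nhds (ofLower_notMem_upperRegion (b := b) (π := π) hq))] with r h1 h2
    convert! h1 using 2 with s
    rw [slideMap_of_notMem _ _ _ (h2 s), toLower_smallLoop, toLower_ofLower]
  · obtain ⟨q, hq, rfl⟩ := Finset.mem_image.mp hp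
    obtain ⟨k1, k2⟩ := b.ξ_mem q hq
    have hev : ∀ᶠ p in 𝓝 (a.ofUpper π q), p ∈ upperRegion a b π := by
      have : ∀ᶠ q' in 𝓝 (a.toUpper π (a.ofUpper π q)), q' ∈ Ioo 0 b.t ×ˢ Ioo (0 : ℝ) 1 :=
        (isOpen_Ioo.prod isOpen_Ioo).mem_nhds (by rw [toUpper_ofUpper]; exact ⟨k1, k2⟩)
      filter_upwards [hU.continuousAt.eventually this] with p hp
      exact ⟨⟨hp.1.1.le, hp.1.2.le⟩, hp.2.1.le⟩
    filter_upwards [hscale.eventually (b.loopIn_fext hq), eventually_smallLoop hev] with r h1 h2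
    have hδ : Continuous fun s : I => a.roof (b.toLower π (smallLoop (a.ofUpper π q) r s)).1 := by
      refine continuous_roof.comp (f := fun s : I =>
        (a, (b.toLower π (smallLoop (a.ofUpper π q) r s)).1)) ?_
      have := (continuous_smallLoop (a.ofUpper π q)).comp (f := fun s : I => (r, s)) (by fun_prop)
      exact continuous_const.prodMk (continuous_fst.comp (hL.comp this))
    convert! h1.act hδ (by rw [smallLoop_zero_eq_one]) using 2 with s
    rw [slideMap_of_mem _ _ _ (h2 s), toUpper_smallLoop, toUpper_ofUpper]

open Classical in
/-- The slide of `b` over `a`, with parameters `π`. -/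
def slide : HurN G c (n + m) where
  t := (a.t + b.t) / π.scale
  ξ := slideξ a b π
  f p := if p ∈ rect ((a.t + b.t) / π.scale) \ slideξ a b π then slideMap a b π p else BG.base
  t_pos := div_pos (add_pos a.t_pos b.t_pos) π.scale_pos
  card_ξ := slideξ_card a b π
  ξ_mem := slideξ_mem a b π
  f_cont := by
    refine (continuousOn_slideMap.comp (f := fun p : ℝ × ℝ => ((a, b, π), p))
      (Continuous.continuousOn (by fun_prop)) fun p hp => hp.2).congr fun p hp => if_pos hp
  f_off p hp := if_neg hp
  f_sqcup p hp := by
    split_ifs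
    exacts [slideMap_sqcup a b π hp, rfl]
  f_loop p hp := by
    obtain ⟨h1, h2⟩ := slideξ_mem a b π p hp
    have hr : ∀ᶠ q in 𝓝 p, q ∈ rect ((a.t + b.t) / π.scale) := by
      filter_upwards [(isOpen_Ioo.prod isOpen_Ioo).mem_nhds (mk_mem_prod h1 h2)] with q hq
      exact ⟨Ioo_subset_Icc_self hq.1, Ioo_subset_Icc_self hq.2⟩
    -- Small circles must avoid all branch points, where `f` has the default value `base`; `p`
    -- itself is avoided because the radius is positive.
    have hξ : ∀ᶠ q in 𝓝 p, q ∉ ((slideξ a b π).erase p : Set (ℝ × ℝ)) :=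
      ((slideξ a b π).erase p).finite_toSet.isClosed.isOpen_compl.mem_nhds
        (Finset.notMem_erase p _)
    filter_upwards [loopIn_slideMap a b π p hp, eventually_smallLoop (hr.and hξ),
      self_mem_nhdsWithin] with r hr h hr0
    convert! hr using 2 with s
    refine if_pos ⟨(h s).1, fun h' => (h s).2 ?_⟩
    exact Finset.mem_coe.mpr (Finset.mem_erase.mpr ⟨smallLoop_ne p hr0 s, h'⟩)

theorem slide_f {p : ℝ × ℝ} (hp : p ∈ rect (slide a b π).t \ (slide a b π).ξ) :
    (slide a b π).f p = slideMap a b π p := if_pos hp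

theorem continuous_slide : Continuous fun z : HurN G c n × HurN G c m × SlideParam =>
    slide z.1 z.2.1 z.2.2 := by
  refine continuous_of_continuousOn_eval ?_ ?_ ?_
  · exact ((continuous_t.comp continuous_fst).add
      (continuous_t.comp (continuous_fst.comp continuous_snd))).div
      (SlideParam.continuous_scale.comp (continuous_snd.comp continuous_snd))
      fun z => z.2.2.scale_pos.ne'
  · refine Conf.continuous_of_eq_union (ξ₁ := fun z => z.1.conf) (ξ₂ := fun z => z.2.1.conf)
      (h₁ := fun z => z.2.1.ofLower z.2.2) (h₂ := fun z => z.1.ofUpper z.2.2)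
      (continuous_conf.comp continuous_fst)
      (continuous_conf.comp (continuous_fst.comp continuous_snd)) ?_ ?_ fun z => rfl
    · exact continuous_ofLower.comp
        (f := fun q : (HurN G c n × HurN G c m × SlideParam) × (ℝ × ℝ) =>
          ((q.1.2.1, q.1.2.2), q.2)) (by fun_prop)
    · exact continuous_ofUpper.comp
        (f := fun q : (HurN G c n × HurN G c m × SlideParam) × (ℝ × ℝ) =>
          ((q.1.1, q.1.2.2), q.2)) (by fun_prop)
  · exact (continuousOn_slideMap.mono fun q hq => hq.2).congr fun q hq => slide_f _ _ _ hq

/-! ### The two ends of the slide -/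

theorem slide_path_zero : slide a b (SlideParam.path 0) = a.mul b := by
  have hL : ∀ p, b.toLower (SlideParam.path 0) p = p := fun p => by
    ext <;> simp [toLower, SlideParam.scale_path_zero, SlideParam.s_path_zero]
  have hU : ∀ p, a.toUpper (SlideParam.path 0) p = (p.1 - a.t, p.2) := fun p => by
    ext <;> simp [toUpper, SlideParam.scale_path_zero, SlideParam.s_path_zero]
  have hL' : ∀ p, b.ofLower (SlideParam.path 0) p = p := fun p => by
    ext <;> simp [ofLower, SlideParam.scale_path_zero, SlideParam.s_path_zero]
  have hU' : ∀ p, a.ofUpper (SlideParam.path 0) p = shift a.t p := fun p => by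
    ext <;> simp [ofUpper, SlideParam.scale_path_zero, SlideParam.s_path_zero, shift]
  have ht : (slide a b (SlideParam.path 0)).t = (a.mul b).t := by
    change (a.t + b.t) / _ = a.t + b.t
    rw [SlideParam.scale_path_zero, div_one]
  have hξ : (slide a b (SlideParam.path 0)).ξ = (a.mul b).ξ := by
    change a.ξ.image _ ∪ b.ξ.image _ = a.ξ ∪ b.ξ.map (shift a.t)
    rw [funext hL', funext hU', Finset.map_eq_image]
    congr 1
    exact Finset.image_id
  refine HurN.ext ht hξ (funext fun p => ?_)
  by_cases hp : p ∈ rect (slide a b (SlideParam.path 0)).t \ (slide a b (SlideParam.path 0)).ξ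
  · rw [slide_f _ _ _ hp]
    obtain ⟨⟨h1, h2⟩, -⟩ := hp
    rw [ht] at h1
    change _ = if p.1 ≤ a.t then a.f p else b.f (p.1 - a.t, p.2)
    split_ifs with h
    · rw [slideMap_of_or, hL, fext_of_le_one _ h2.2]
      left; rw [hU]; exact sub_nonpos.mpr h
    · have h1' : p.1 ≤ a.t + b.t := h1.2
      rw [not_le] at h
      rw [slideMap_of_mem, hL, hU, roof_of_right _ h.le, BG.act_base_right,
        b.fext_of_le_one (p := (p.1 - a.t, p.2)) h2.2]
      rw [upperRegion, mem_ofPred_eq, hU]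
      exact ⟨⟨by simp only; linarith, by simp only; linarith⟩, h2.1⟩
  · rw [f_off _ _ hp, f_off _ _ (by rwa [← ht, ← hξ])]

/-- The two sides live in `HurN G c (n + m)` and `HurN G c (m + n)`, so the end of the slide is
compared component by component and assembled by `Hur.of_eq_of`. -/
theorem slide_path_one_t :
    (slide a b (SlideParam.path 1)).t = ((b.conjAct a.μ).mul a).t := by
  change (a.t + b.t) / _ = b.t + a.t
  rw [SlideParam.scale_path_one, div_one, add_comm]

theorem slide_path_one_ξ :
    (slide a b (SlideParam.path 1)).ξ = ((b.conjAct a.μ).mul a).ξ := by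
  have hL' : ∀ p, b.ofLower (SlideParam.path 1) p = shift b.t p := fun p => by
    ext <;> simp [ofLower, SlideParam.scale_path_one, SlideParam.s_path_one, shift]
  have hU' : ∀ p, a.ofUpper (SlideParam.path 1) p = p := fun p => by
    ext <;> simp [ofUpper, SlideParam.scale_path_one, SlideParam.s_path_one]
  change a.ξ.image _ ∪ b.ξ.image _ = b.ξ ∪ a.ξ.map (shift b.t)
  rw [funext hL', funext hU', Finset.map_eq_image, Finset.union_comm]
  congr 1
  exact Finset.image_id

theorem slide_path_one_f :
    (slide a b (SlideParam.path 1)).f = ((b.conjAct a.μ).mul a).f := by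
  have hL : ∀ p, b.toLower (SlideParam.path 1) p = (p.1 - b.t, p.2) := fun p => by
    ext <;> simp [toLower, SlideParam.scale_path_one, SlideParam.s_path_one]
  have hU : ∀ p, a.toUpper (SlideParam.path 1) p = p := fun p => by
    ext <;> simp [toUpper, SlideParam.scale_path_one, SlideParam.s_path_one]
  have ht := slide_path_one_t a b
  have hξ := slide_path_one_ξ a b
  refine funext fun p => ?_
  by_cases hp : p ∈ rect (slide a b (SlideParam.path 1)).t \ (slide a b (SlideParam.path 1)).ξ
  · rw [slide_f _ _ _ hp]
    obtain ⟨⟨h1, h2⟩, -⟩ := hp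
    change _ = if p.1 ≤ b.t then BG.conj a.μ (b.f p) else a.f (p.1 - b.t, p.2)
    split_ifs with h
    -- To the left of `a` the lift is constant at `a.μ⁻¹ • base`, which acts as conjugation by
    -- `a.μ`.
    · rw [slideMap_of_mem, hL, hU, roof_of_left _ (sub_nonpos.mpr h), BG.act_smul_base,
        fext_of_le_one _ h2.2]
      rw [upperRegion, mem_ofPred_eq, hU]
      exact ⟨⟨h1.1, h⟩, h2.1⟩
    · rw [slideMap_of_or, hL, a.fext_of_le_one (p := (p.1 - b.t, p.2)) h2.2]
      right; left; rw [hU]; exact (not_le.mp h).le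
  · rw [f_off _ _ hp, f_off _ _ (by rwa [← ht, ← hξ])]

end HurN

/-! ### The conjugation action and the homotopy on the disjoint union -/

namespace HurN

variable {G : Type u} [Group G] {c : Set G} {n m : ℕ}

theorem continuous_conjAct (h : G) : Continuous (conjAct (c := c) (n := n) h) :=
  continuous_of_continuousOn_eval continuous_t continuous_conf
    ((BG.continuous_conj h).comp_continuousOn continuousOn_eval)

theorem conjAct_one (a : HurN G c n) : a.conjAct 1 = a :=
  HurN.ext rfl rfl (funext fun p => BG.conj_one (a.f p))

theorem conjAct_conjAct (g h : G) (a : HurN G c n) :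
    (a.conjAct h).conjAct g = a.conjAct (g * h) :=
  HurN.ext rfl rfl (funext fun p => BG.conj_conj g h (a.f p))

theorem conjAct_mul (h : G) (a : HurN G c n) (b : HurN G c m) :
    (a.mul b).conjAct h = (a.conjAct h).mul (b.conjAct h) :=
  HurN.ext rfl rfl (funext fun _ => apply_ite (BG.conj h) _ _ _)

end HurN

namespace Hur

variable {G : Type u} [Group G] {c : Set G}

/-- The inclusion of a component with at least one branch point. -/
def of (n : ℕ+) (a : HurN G c n) : Hur G c := Sum.inr ⟨n, a⟩

theorem isOpenEmbedding_of (n : ℕ+) : IsOpenEmbedding (of (G := G) (c := c) n) :=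
  IsOpenEmbedding.inr.comp IsOpenEmbedding.sigmaMk

theorem isOpenEmbedding_one :
    IsOpenEmbedding (fun _ : Unit => (1 : Hur G c)) :=
  (IsOpenEmbedding.inl : IsOpenEmbedding (Sum.inl : Unit → Unit ⊕ (Σ n : ℕ+, HurN G c n)))

theorem eq_one_or_of (a : Hur G c) : a = 1 ∨ ∃ n a', a = of n a' := by
  rcases a with ⟨⟩ | ⟨n, a⟩
  exacts [Or.inl rfl, Or.inr ⟨n, a, rfl⟩]

theorem of_eq_of {n m : ℕ+} (h : n = m) {a : HurN G c n} {b : HurN G c m} (ht : a.t = b.t)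
    (hξ : a.ξ = b.ξ) (hf : a.f = b.f) : of n a = of m b := by
  subst h
  rw [HurN.ext ht hξ hf]

theorem one_mul (a : Hur G c) : 1 * a = a := by
  rcases a with ⟨⟩ | ⟨n, a⟩ <;> rfl

theorem mul_one (a : Hur G c) : a * 1 = a := by
  rcases a with ⟨⟩ | ⟨n, a⟩ <;> rfl

theorem of_mul_of {n m : ℕ+} (a : HurN G c n) (b : HurN G c m) :
    of n a * of m b = of (n + m) (a.mul b) := rfl

theorem smul_one (g : G) : g • (1 : Hur G c) = 1 := rfl

theorem smul_of (g : G) {n : ℕ+} (a : HurN G c n) : g • of n a = of n (a.conjAct g) := rfl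

instance : MulAction G (Hur G c) where
  one_smul a := by
    rcases a.eq_one_or_of with rfl | ⟨n, a, rfl⟩
    · rfl
    · rw [smul_of, HurN.conjAct_one]
  mul_smul g h a := by
    rcases a.eq_one_or_of with rfl | ⟨n, a, rfl⟩
    · rfl
    · rw [smul_of, smul_of, smul_of, HurN.conjAct_conjAct]

theorem smul_mul (g : G) (a b : Hur G c) : g • (a * b) = (g • a) * (g • b) := by
  rcases a.eq_one_or_of with rfl | ⟨n, a, rfl⟩
  · rw [smul_one, one_mul, one_mul]
  rcases b.eq_one_or_of with rfl | ⟨m, b, rfl⟩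
  · rw [smul_one, mul_one, mul_one]
  · exact congrArg (of (n + m)) (HurN.conjAct_mul g a b)

/-- The action of an element of `G`, as a continuous map. -/
def smulMap (g : G) : C(Hur G c, Hur G c) where
  toFun a := g • a
  continuous_toFun := by
    refine continuous_iff_continuousAt.mpr fun a => ?_
    rcases a.eq_one_or_of with rfl | ⟨n, a, rfl⟩
    · refine (isOpenEmbedding_one.continuousAt_iff (x := ())).mp ?_
      exact continuousAt_const
    · refine ((isOpenEmbedding_of n).continuousAt_iff (x := a)).mp ?_
      exact ((isOpenEmbedding_of n).continuous.comp (HurN.continuous_conjAct g)).continuousAt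

/-- The slide of the second factor over the first. -/
def slide : Hur G c → Hur G c → SlideParam → Hur G c
  | Sum.inl _, b, _ => b
  | Sum.inr a, Sum.inl _, _ => Sum.inr a
  | Sum.inr ⟨n, a⟩, Sum.inr ⟨m, b⟩, π => of (n + m) (HurN.slide a b π)

theorem one_slide (b : Hur G c) (π : SlideParam) : slide 1 b π = b := rfl

theorem slide_one (a : Hur G c) (π : SlideParam) : slide a 1 π = a := by
  rcases a with ⟨⟩ | ⟨n, a⟩ <;> rfl

theorem of_slide_of {n m : ℕ+} (a : HurN G c n) (b : HurN G c m) (π : SlideParam) :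
    slide (of n a) (of m b) π = of (n + m) (HurN.slide a b π) := rfl

theorem continuous_slide :
    Continuous fun z : Hur G c × Hur G c × SlideParam => slide z.1 z.2.1 z.2.2 := by
  refine continuous_iff_continuousAt.mpr fun ⟨a, b, π⟩ => ?_
  rcases a.eq_one_or_of with rfl | ⟨n, a, rfl⟩
  · refine ((isOpenEmbedding_one.prodMap .id).continuousAt_iff (x := ((), b, π))).mp ?_
    exact (continuous_fst.comp continuous_snd).continuousAt
  rcases b.eq_one_or_of with rfl | ⟨m, b, rfl⟩
  · refine ((IsOpenEmbedding.id.prodMap (isOpenEmbedding_one.prodMap .id)).continuousAt_iff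
      (x := (of n a, (), π))).mp ?_
    refine ContinuousAt.congr (f := Prod.fst) continuous_fst.continuousAt
      (Eventually.of_forall fun z => (slide_one z.1 z.2.2).symm)
  · refine (((isOpenEmbedding_of n).prodMap ((isOpenEmbedding_of m).prodMap
      .id)).continuousAt_iff (x := (a, b, π))).mp ?_
    exact ((isOpenEmbedding_of (n + m)).continuous.comp HurN.continuous_slide).continuousAt

theorem slide_path_zero (a b : Hur G c) : slide a b (SlideParam.path 0) = a * b := by
  rcases a.eq_one_or_of with rfl | ⟨n, a, rfl⟩
  · rw [one_slide, one_mul]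
  rcases b.eq_one_or_of with rfl | ⟨m, b, rfl⟩
  · rw [slide_one, mul_one]
  · exact congrArg (of (n + m)) (HurN.slide_path_zero a b)

theorem slide_path_one (a b : Hur G c) : slide a b (SlideParam.path 1) = (μ a • b) * a := by
  rcases a.eq_one_or_of with rfl | ⟨n, a, rfl⟩
  · rw [one_slide, mul_one]
    exact (one_smul G b).symm
  rcases b.eq_one_or_of with rfl | ⟨m, b, rfl⟩
  · rw [slide_one, smul_one, one_mul]
  · rw [of_slide_of, smul_of, of_mul_of]
    exact of_eq_of (add_comm n m) (HurN.slide_path_one_t a b) (HurN.slide_path_one_ξ a b)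
      (HurN.slide_path_one_f a b)

variable (G c) in
/-- The multiplication, as a continuous map. -/
def mulMap : C(Hur G c × Hur G c, Hur G c) where
  toFun z := z.1 * z.2
  continuous_toFun := by
    -- The product is the slide at a fixed parameter, so its continuity comes from that of the
    -- slide; the same holds for the twisted product.
    simp only [← slide_path_zero]
    exact continuous_slide.comp (f := fun z : Hur G c × Hur G c => (z.1, z.2, SlideParam.path 0))
      (by fun_prop)

variable (G c) in
/-- The multiplication twisted by the global monodromy, as a continuous map. -/
def twistedMulMap : C(Hur G c × Hur G c, Hur G c) where
  toFun z := (μ z.1 • z.2) * z.1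
  continuous_toFun := by
    simp only [← slide_path_one]
    exact continuous_slide.comp (f := fun z : Hur G c × Hur G c => (z.1, z.2, SlideParam.path 1))
      (by fun_prop)

variable (G c) in
/-- The homotopy that slides the second factor over the first. -/
def mulHomotopy : (mulMap G c).Homotopy (twistedMulMap G c) where
  toFun z := slide z.2.1 z.2.2 (SlideParam.path z.1)
  continuous_toFun := continuous_slide.comp
    (f := fun z : I × (Hur G c × Hur G c) => (z.2.1, z.2.2, SlideParam.path z.1)) (by fun_prop)
  map_zero_left z := slide_path_zero z.1 z.2
  map_one_left z := slide_path_one z.1 z.2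

end Hur

/-! ### Homology -/

section Homology

variable (k : Type u) [Field k] {X Y Z : Type u} [TopologicalSpace X] [TopologicalSpace Y]
  [TopologicalSpace Z]

theorem homologyMap_id (r : TotalHomology k X) : homologyMap k (ContinuousMap.id X) r = r := by
  refine DFinsupp.ext fun d => ?_
  change (((AlgebraicTopology.singularHomologyFunctor (ModuleCat.{u} k) d).obj
    (ModuleCat.of k k)).map (CategoryTheory.CategoryStruct.id (TopCat.of X))).hom (r d) = r d
  rw [CategoryTheory.Functor.map_id]
  rfl

theorem homologyMap_comp (ψ : C(Y, Z)) (φ : C(X, Y)) (r : TotalHomology k X) :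
    homologyMap k (ψ.comp φ) r = homologyMap k ψ (homologyMap k φ r) := by
  refine DFinsupp.ext fun d => ?_
  change (((AlgebraicTopology.singularHomologyFunctor (ModuleCat.{u} k) d).obj
    (ModuleCat.of k k)).map (CategoryTheory.CategoryStruct.comp (TopCat.ofHom φ)
      (TopCat.ofHom ψ))).hom (r d) = _
  rw [CategoryTheory.Functor.map_comp]
  rfl

theorem homologyMap_congr {φ ψ : C(X, Y)} (h : φ.Homotopic ψ) :
    homologyMap k φ = homologyMap k ψ := by
  obtain ⟨H⟩ := h
  have key : ∀ d, ((AlgebraicTopology.singularHomologyFunctor (ModuleCat.{u} k) d).obj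
      (ModuleCat.of k k)).map (TopCat.ofHom φ) =
      ((AlgebraicTopology.singularHomologyFunctor (ModuleCat.{u} k) d).obj
      (ModuleCat.of k k)).map (TopCat.ofHom ψ) := fun d =>
    TopCat.Homotopy.congr_homologyMap_singularChainComplexFunctor
      (f := TopCat.ofHom φ) (g := TopCat.ofHom ψ) H (ModuleCat.of k k) d
  simp only [homologyMap, key]

end Homology

/-! ### Right fractions in homology -/

namespace Hur

variable {G : Type u} [Group G] {c : Set G} (k : Type u) [Field k]

theorem homologyMap_smulMap_smulMap (g h : G) (r : TotalHomology k (Hur G c)) :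
    homologyMap k (smulMap g) (homologyMap k (smulMap h) r) =
      homologyMap k (smulMap (g * h)) r := by
  rw [← homologyMap_comp]
  congr 2
  exact ContinuousMap.ext fun a => (mul_smul g h a).symm

theorem homologyMap_smulMap_one (r : TotalHomology k (Hur G c)) :
    homologyMap k (smulMap 1) r = r := by
  have h : smulMap 1 = ContinuousMap.id (Hur G c) := ContinuousMap.ext fun a => one_smul G a
  rw [h, homologyMap_id]

/-- Left multiplication by `a` is right multiplication by `a` after acting by the monodromy. -/
theorem leftMulPoint_eq (a : Hur G c) (r : TotalHomology k (Hur G c)) :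
    leftMulPoint k (mulMap G c) a r =
      rightMulPoint k (mulMap G c) a (homologyMap k (smulMap (μ a)) r) := by
  have h : ((mulMap G c).comp ((ContinuousMap.const _ a).prodMk (ContinuousMap.id _))).Homotopic
      ((twistedMulMap G c).comp ((ContinuousMap.const _ a).prodMk (ContinuousMap.id _))) :=
    ContinuousMap.Homotopic.comp ⟨mulHomotopy G c⟩ (.refl _)
  rw [leftMulPoint, homologyMap_congr k h, rightMulPoint, ← homologyMap_comp]
  rfl

/-- `G` acts by automorphisms of the product: `(g * x) · a = g * (x · (g⁻¹ * a))`. -/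
theorem rightMulPoint_smulMap (g : G) (a : Hur G c) (r : TotalHomology k (Hur G c)) :
    rightMulPoint k (mulMap G c) a (homologyMap k (smulMap g) r) =
      homologyMap k (smulMap g) (rightMulPoint k (mulMap G c) (g⁻¹ • a) r) := by
  rw [rightMulPoint, rightMulPoint, ← homologyMap_comp, ← homologyMap_comp]
  congr 2
  refine ContinuousMap.ext fun x => ?_
  change (g • x) * a = g • (x * g⁻¹ • a)
  rw [smul_mul, smul_inv_smul]

theorem exists_rightMulPoint_eq (r : TotalHomology k (Hur G c)) (a : Hur G c) :
    ∃ r' a', rightMulPoint k (mulMap G c) a' r = leftMulPoint k (mulMap G c) a r' := by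
  -- Moving `a` past `r'` acts on `r'` by `μ a`; the inverse action is applied in advance, and `s' =
  -- s` works.
  refine ⟨homologyMap k (smulMap (μ a)⁻¹) r, a, ?_⟩
  rw [leftMulPoint_eq, homologyMap_smulMap_smulMap, mul_inv_cancel, homologyMap_smulMap_one]

theorem exists_rightMulPoint_eq_zero {r : TotalHomology k (Hur G c)} {a : Hur G c}
    (h : leftMulPoint k (mulMap G c) a r = 0) : ∃ a', rightMulPoint k (mulMap G c) a' r = 0 := by
  -- Here `[a] · r = (μ(a) * r) · [a] = μ(a) * (r · [μ(a)⁻¹ * a])`, and the outer action is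
  -- invertible.
  refine ⟨(μ a)⁻¹ • a, ?_⟩
  rw [leftMulPoint_eq, rightMulPoint_smulMap] at h
  have h' := congrArg (homologyMap k (smulMap (μ a)⁻¹)) h
  rwa [homologyMap_smulMap_smulMap, inv_mul_cancel, homologyMap_smulMap_one, map_zero] at h'

end Hur

end

theorem mainTheorem11 {G : Type u} [Group G] (c : Set G)
    (hc : ∀ g ∈ c, ∀ h : G, h * g * h⁻¹ ∈ c) :
    ∃ m₁ m₂ : C(Hur G c × Hur G c, Hur G c),
      (∀ a b, m₁ (a, b) = a * b) ∧
      (∀ a b, m₂ (a, b) = (Hur.μ a • b) * a) ∧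
      m₁.Homotopic m₂ ∧
      ∀ (k : Type u) [Field k] (r : TotalHomology k (Hur G c)) (a : Hur G c),
        (∃ r' a', rightMulPoint k m₁ a' r = leftMulPoint k m₁ a r') ∧
        (leftMulPoint k m₁ a r = 0 → ∃ a', rightMulPoint k m₁ a' r = 0) :=
  ⟨Hur.mulMap G c, Hur.twistedMulMap G c, fun _ _ => rfl, fun _ _ => rfl, ⟨Hur.mulHomotopy G c⟩,
    fun k _ r a => ⟨Hur.exists_rightMulPoint_eq k r a, Hur.exists_rightMulPoint_eq_zero k⟩⟩
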